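/- Let $p,n\in\mathbb N$ with $n\ge 1$, and let $I_p$ be the $p\times p$ identity matrix. All matrices are complex; $M>0$ means that $M$ is Hermitian positive definite. Put $$j=\begin{bmatrix} I_p&0\\0&-I_p\end{bmatrix},\qquad K=\frac1{\sqrt2}\begin{bmatrix} I_p&-I_p\\ I_p&I_p\end{bmatrix}.$$ Let $S(n)=\{s_{j-i}\}_{i,j=1}^n>0$ be a block Toeplitz matrix with $p\times p$ blocks and let $\nu=\nu^*$ be a $p\times p$ matrix. For $1\le k\le n$ let $S(k)=\{s_{j-i}\}_{i,j=1}^k$, let $E_k=[0\ \cdots\ 0\ I_p]$ be the $p\times kp$ block row, let $\Phi_1(k)$ be the $kp\times p$ block column all of whose blocks are $I_p$, and let $\Phi_2(k)$ be the $kp\times p$ block column whose $i$-th block $(1\le i\le k)$ is $\frac12 s_0+s_{-1}+\dots+s_{1-i}+\mathrm i\nu$. Put $$t_k=E_kS(k)^{-1}E_k^*,\qquad [X_k\ \ Y_k]=E_kS(k)^{-1}[\Phi_1(k)\ \ \Phi_2(k)],$$ $$\beta(k)=t_{k+1}^{-1/2}[X_{k+1}\ \ Y_{k+1}]\qquad(0\le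 k<n).$$ A discrete Dirac system (on $0\le k<n$) is a system $$W_{k+1}(\lambda)-W_k(\lambda)=-\frac{\mathrm i}{\lambda}\,jC_kW_k(\lambda)\qquad(0\le k<n,\ \lambda\in\mathbb C\setminus\{0\})$$ for $2p\times 2p$ matrix functions $W_0,\dots,W_n$, with $2p\times2p$ coefficients $C_k$ such that $C_k>0$ and $C_kjC_k=j$ $(0\le k<n)$. Theorem. The formula $$C_k=2K^*\beta(k)^*\beta(k)K-j\qquad(0\le k<n)$$ defines a one-to-one correspondence (a bijection) between the pairs $\{S(n),\nu\}$, where $S(n)>0$ is a block Toeplitz matrix with $n\times n$ blocks of size $p\times p$ and $\nu=\nu^*$ is a $p\times p$ matrix, and the discrete Dirac systems on $0\le k<n$. This holds both when a Dirac system is identified with its sequence of coefficients $\{C_k\}_{0\le k<n}$ and when it is identified with the set of its matrix solutions $(W_0,\dots,W_n)$. -/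

import Mathlib

open Matrix
open scoped ComplexOrder

namespace ToeplitzDirac

/-- A square matrix of `n × n` blocks of size `p × p`; `((i, a), (j, b))` is the index of the
`(a, b)` entry of the block in position `(i, j)`. -/
abbrev BlockMatrix (p n : ℕ) : Type := Matrix (Fin n × Fin p) (Fin n × Fin p) ℂ

/-- `2p × 2p` matrices, partitioned into four `p × p` blocks. -/
abbrev Mat2 (p : ℕ) : Type := Matrix (Fin p ⊕ Fin p) (Fin p ⊕ Fin p) ℂ

/-- The `p × p` block of `S` in position `(i, j)`. -/
def block {p n : ℕ} (S : BlockMatrix p n) (i j : Fin n) : Matrix (Fin p) (Fin p) ℂ :=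
  Matrix.of fun a b => S (i, a) (j, b)

/-- `S = {s_{j-i}}` for some `p × p` matrices `s_k`. -/
def IsBlockToeplitz {p n : ℕ} (S : BlockMatrix p n) : Prop :=
  ∃ s : ℤ → Matrix (Fin p) (Fin p) ℂ, ∀ i j : Fin n, block S i j = s ((j : ℤ) - (i : ℤ))

/-- The pairs `{S, ν}` with `S > 0` block Toeplitz and `ν = ν^*`. -/
def toeplitzPairs (p n : ℕ) : Set (BlockMatrix p n × Matrix (Fin p) (Fin p) ℂ) :=
  {q | IsBlockToeplitz q.1 ∧ q.1.PosDef ∧ q.2.IsHermitian}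

/-- The leading principal part `S(k+1)` of `S = S(n)`, consisting of `k+1` block rows and
columns (`0 ≤ k < n`). -/
def leading {p n : ℕ} (S : BlockMatrix p n) (k : Fin n) : BlockMatrix p (k + 1) :=
  S.submatrix (fun x => (Fin.castLE k.isLt x.1, x.2)) (fun x => (Fin.castLE k.isLt x.1, x.2))

/-- The block row `[0 … 0 I_p]` with `m+1` blocks. -/
def lastRow (p m : ℕ) : Matrix (Fin p) (Fin (m + 1) × Fin p) ℂ :=
  Matrix.of fun a x => if x.1 = Fin.last m ∧ x.2 = a then 1 else 0

/-- The block column `Φ₁` all of whose `m` blocks are `I_p`. -/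
def Phi1 (p m : ℕ) : Matrix (Fin m × Fin p) (Fin p) ℂ :=
  Matrix.of fun x b => (1 : Matrix (Fin p) (Fin p) ℂ) x.2 b

/-- The block column `Φ₂` whose block number `i` (counted from `0`) is
`s_0 / 2 + s_{-1} + … + s_{-i} + iν`; here `s_{-l}` is the block of `S` in position `(l, 0)`. -/
noncomputable def Phi2 {p m : ℕ} (S : BlockMatrix p (m + 1)) (ν : Matrix (Fin p) (Fin p) ℂ) :
    Matrix (Fin (m + 1) × Fin p) (Fin p) ℂ :=
  Matrix.of fun x b =>
    ((1 / 2 : ℂ) • block S 0 0 + ∑ l ∈ Finset.Ioc 0 x.1, block S l 0 + Complex.I • ν) x.2 b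

/-- `t = [0 … 0 I_p] S⁻¹ [0 … 0 I_p]^*`. -/
noncomputable def tMat {p m : ℕ} (S : BlockMatrix p (m + 1)) : Matrix (Fin p) (Fin p) ℂ :=
  lastRow p m * S⁻¹ * (lastRow p m)ᴴ

/-- `[X Y] = [0 … 0 I_p] S⁻¹ [Φ₁ Φ₂]`. -/
noncomputable def XY {p m : ℕ} (S : BlockMatrix p (m + 1)) (ν : Matrix (Fin p) (Fin p) ℂ) :
    Matrix (Fin p) (Fin p ⊕ Fin p) ℂ :=
  lastRow p m * S⁻¹ * Matrix.fromCols (Phi1 p (m + 1)) (Phi2 S ν)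

/-- `t^{-1/2}`, through the continuous functional calculus of Hermitian matrices. -/
noncomputable def invSqrt {p : ℕ} (t : Matrix (Fin p) (Fin p) ℂ) : Matrix (Fin p) (Fin p) ℂ :=
  cfc (fun x : ℝ => x ^ (-(1 / 2) : ℝ)) t

/-- `β(k) = t_{k+1}^{-1/2} [X_{k+1} Y_{k+1}]`, all formed from `S(k+1)` and `ν`. -/
noncomputable def beta {p n : ℕ} (S : BlockMatrix p n) (ν : Matrix (Fin p) (Fin p) ℂ)
    (k : Fin n) : Matrix (Fin p) (Fin p ⊕ Fin p) ℂ :=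
  invSqrt (tMat (leading S k)) * XY (leading S k) ν

/-- `j = diag(I_p, -I_p)`. -/
def jMat (p : ℕ) : Mat2 p := Matrix.fromBlocks 1 0 0 (-1)

/-- `K = (1/√2) [[I_p, -I_p], [I_p, I_p]]`. -/
noncomputable def KMat (p : ℕ) : Mat2 p :=
  ((1 / Real.sqrt 2 : ℝ) : ℂ) • Matrix.fromBlocks 1 (-1) 1 1

/-- `C_k = 2 K^* β(k)^* β(k) K - j` for `0 ≤ k < n`. -/
noncomputable def potential {p n : ℕ} (q : BlockMatrix p n × Matrix (Fin p) (Fin p) ℂ) :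
    Fin n → Mat2 p :=
  fun k => (2 : ℂ) • ((KMat p)ᴴ * (beta q.1 q.2 k)ᴴ * beta q.1 q.2 k * KMat p) - jMat p

/-- The coefficient sequences of Dirac systems: `C_k > 0` and `C_k j C_k = j` for `0 ≤ k < n`. -/
def diracPotentials (p n : ℕ) : Set (Fin n → Mat2 p) :=
  {C | ∀ k, (C k).PosDef ∧ C k * jMat p * C k = jMat p}

/-- The discrete system `W_{k+1}(z) - W_k(z) = -(i/z) j C_k W_k(z)` (`0 ≤ k < n`, `z ≠ 0`) with
coefficients `C_k`, as the set of its matrix solutions `W_0, …, W_n`. -/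
def diracSystem {p n : ℕ} (C : Fin n → Mat2 p) : Set (Fin (n + 1) → ℂ → Mat2 p) :=
  {W | ∀ k : Fin n, ∀ z : ℂ, z ≠ 0 →
    W k.succ z - W k.castSucc z = (-(Complex.I / z)) • (jMat p * C k * W k.castSucc z)}

/-- All discrete Dirac systems on `0 ≤ k < n`. -/
def diracSystems (p n : ℕ) : Set (Set (Fin (n + 1) → ℂ → Mat2 p)) :=
  {E | ∃ C ∈ diracPotentials p n, E = diracSystem C}

end ToeplitzDirac

/-! Write `J` for `swapMat p = K j K^*`. The coefficients with `C > 0` and `C j C = j` are exactly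
the matrices `2γ^*γ - j` with `γ j γ^* = 1`. With `γ = βK`, choosing `C_k` amounts to choosing
`β(k)^*β(k)` subject to `β(k) J β(k)^* = 1`.

The Toeplitz side is governed by the displacement identity `A S + S A^* = Φ J Φ^*`
(`halfSum_mul_toeplitz`). Compressed by block elimination it says `M J M^* = δ`, where `δ = schur s
k`, `M = schurRow s ν k` and `β(k)^*β(k) = M^* δ⁻¹ M`. Hence `β J β^* = 1`, and positivity of `δ`,
the condition for extending `S(k) > 0`, can be read off from `M`.

Pairs and coefficients are then matched one index at a time. For `k = 0`, `M = [I, s_0/2 + iν]`. For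
`k ≥ 1` with the earlier blocks fixed, `M` is affine in the new block `s_{-k}`: `M = X + σY`, with
`X` taken at the central extension, where `X J X^* > 0`, and `Y J Y^* < 0` (`edgeRow_negative`). So
`X` and `Y` together are invertible, and every `β` with `β J β^* = 1` is `A(X + σY)` with `A`
invertible (`exists_eq_mul_add_mul`); `σ` is determined by `β^*β`
(`eq_of_conjTranspose_mul_mul_eq`).

Finally, a system determines its coefficients because it has a solution that is invertible at `z =
1`. -/

namespace ToeplitzDirac

/-! ### Coefficients `C` as matrices `2γ^*γ - j` -/

section

variable {p : ℕ}

theorem KMat_mul_conjTranspose : KMat p * (KMat p)ᴴ = 1 := by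
  have h : (((1 / Real.sqrt 2 : ℝ) : ℂ) * ((1 / Real.sqrt 2 : ℝ) : ℂ)) = 1 / 2 := by
    rw [← Complex.ofReal_mul]
    norm_num [← mul_inv]
  simp only [KMat, conjTranspose_smul, fromBlocks_conjTranspose, smul_mul_assoc, mul_smul_comm,
    smul_smul, fromBlocks_multiply, Complex.star_def, Complex.conj_ofReal, h]
  rw [← fromBlocks_one, fromBlocks_smul]
  congr 1 <;> simp [← two_smul ℂ (1 : Matrix (Fin p) (Fin p) ℂ)]

theorem KMat_conjTranspose_mul : (KMat p)ᴴ * KMat p = 1 :=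
  mul_eq_one_comm.mp KMat_mul_conjTranspose

/-- The signature matrix `[[0, I_p], [I_p, 0]]`. -/
def swapMat (p : ℕ) : Mat2 p := Matrix.fromBlocks 0 1 1 0

theorem KMat_mul_jMat_mul : KMat p * jMat p * (KMat p)ᴴ = swapMat p := by
  have h : (((1 / Real.sqrt 2 : ℝ) : ℂ) * ((1 / Real.sqrt 2 : ℝ) : ℂ)) = 1 / 2 := by
    rw [← Complex.ofReal_mul]
    norm_num [← mul_inv]
  simp only [KMat, jMat, swapMat, conjTranspose_smul, fromBlocks_conjTranspose, smul_mul_assoc,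
    mul_smul_comm, smul_smul, fromBlocks_multiply, Complex.star_def, Complex.conj_ofReal, h]
  rw [fromBlocks_smul]
  congr 1 <;> simp [← two_smul ℂ (1 : Matrix (Fin p) (Fin p) ℂ)]

theorem jMat_mul_self : jMat p * jMat p = 1 := by
  simp [jMat, fromBlocks_multiply]

theorem isUnit_of_mul_conjTranspose_posDef {m : Type*} [Fintype m] [DecidableEq m]
    {a : Matrix m m ℂ} (h : (a * aᴴ).PosDef) : IsUnit a := by
  rw [isUnit_iff_isUnit_det]
  have := (isUnit_iff_isUnit_det _).mp h.isUnit
  rw [det_mul] at this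
  exact isUnit_of_mul_isUnit_left this

/-- `γ^*γ j` is idempotent, so `C j = 2γ^*γ j - 1` is an involution. -/
theorem two_smul_sub_jMat_mul {γ : Matrix (Fin p) (Fin p ⊕ Fin p) ℂ} (h : γ * jMat p * γᴴ = 1) :
    ((2 : ℂ) • (γᴴ * γ) - jMat p) * jMat p * ((2 : ℂ) • (γᴴ * γ) - jMat p) = jMat p := by
  have h1 : γᴴ * γ * jMat p * (γᴴ * γ) = γᴴ * γ := by
    calc γᴴ * γ * jMat p * (γᴴ * γ) = γᴴ * (γ * jMat p * γᴴ) * γ := by simp only [Matrix.mul_assoc]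
      _ = γᴴ * γ := by rw [h, Matrix.mul_one]
  have h2 := jMat_mul_self (p := p)
  simp only [sub_mul, mul_sub, smul_mul_assoc, mul_smul_comm, h1, h2, Matrix.one_mul,
    Matrix.mul_assoc _ (jMat p) (jMat p), Matrix.mul_one]
  module

/-- With `γ = [a b]`, the relation `aa^* = 1 + bb^*` makes `a` invertible. For `V = [a b; 0 1]` and
`L` the first block row of `V⁻¹`, it also gives `LL^* = 1`, so `1 - L^*L` is a projection. Then
`γ^*γ - j = V^*(1 - L^*L)V` is semidefinite and `C` is a sum of two semidefinite matrices. It is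
invertible with inverse `jCj`. -/
theorem two_smul_sub_jMat_posDef {γ : Matrix (Fin p) (Fin p ⊕ Fin p) ℂ}
    (h : γ * jMat p * γᴴ = 1) : ((2 : ℂ) • (γᴴ * γ) - jMat p).PosDef := by
  have hC := two_smul_sub_jMat_mul h
  obtain ⟨a, b, rfl⟩ : ∃ a b, γ = fromCols a b := ⟨_, _, (fromCols_toCols γ).symm⟩
  have hab : a * aᴴ = 1 + b * bᴴ := by
    simp only [jMat, fromCols_mul_fromBlocks, conjTranspose_fromCols_eq_fromRows_conjTranspose,
      fromCols_mul_fromRows, Matrix.mul_one, Matrix.mul_zero, Matrix.mul_neg, Matrix.neg_mul,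
      add_zero, zero_add] at h
    rw [← h]; abel
  have hu : IsUnit a.det := (isUnit_iff_isUnit_det _).mp <| isUnit_of_mul_conjTranspose_posDef
    (hab ▸ PosDef.one.add_posSemidef (posSemidef_self_mul_conjTranspose b))
  set L : Matrix (Fin p) (Fin p ⊕ Fin p) ℂ := a⁻¹ * fromCols 1 (-b) with hL
  set V : Mat2 p := fromRows (fromCols a b) (fromCols 0 1) with hV
  have hLL : L * Lᴴ = 1 := by
    rw [hL, conjTranspose_mul, Matrix.mul_assoc, ← Matrix.mul_assoc _ _ (a⁻¹)ᴴ,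
      conjTranspose_fromCols_eq_fromRows_conjTranspose, fromCols_mul_fromRows]
    simp only [conjTranspose_one, conjTranspose_neg, Matrix.mul_one, Matrix.neg_mul,
      Matrix.mul_neg, neg_neg, ← hab]
    rw [conjTranspose_nonsing_inv, Matrix.mul_assoc, mul_nonsing_inv, Matrix.mul_one,
      nonsing_inv_mul _ hu]
    rw [det_conjTranspose]; exact hu.star
  have hLV : L * V = fromCols 1 0 := by
    rw [hL, hV, Matrix.mul_assoc, fromCols_mul_fromRows, Matrix.one_mul, mul_fromCols]
    have : fromCols a b + fromCols (-b * 0) (-b * 1) = fromCols a 0 := by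
      ext i (j | j) <;> simp
    rw [this, mul_fromCols, nonsing_inv_mul _ hu, Matrix.mul_zero]
  have hVV : Vᴴ * V = (fromCols a b)ᴴ * fromCols a b +
      (fromCols 0 (1 : Matrix (Fin p) (Fin p) ℂ))ᴴ * fromCols 0 (1 : Matrix (Fin p) (Fin p) ℂ) := by
    rw [hV, conjTranspose_fromRows_eq_fromCols_conjTranspose, fromCols_mul_fromRows]
  have hj : jMat p = (fromCols (1 : Matrix (Fin p) (Fin p) ℂ) 0)ᴴ *
        fromCols (1 : Matrix (Fin p) (Fin p) ℂ) 0 -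
      (fromCols 0 (1 : Matrix (Fin p) (Fin p) ℂ))ᴴ * fromCols 0 (1 : Matrix (Fin p) (Fin p) ℂ) := by
    simp only [conjTranspose_fromCols_eq_fromRows_conjTranspose, fromRows_mul_fromCols]
    ext (i | i) (k | k) <;> simp [jMat]
  have key : (2 : ℂ) • ((fromCols a b)ᴴ * fromCols a b) - jMat p =
      (fromCols a b)ᴴ * fromCols a b + ((1 - Lᴴ * L) * V)ᴴ * ((1 - Lᴴ * L) * V) := by
    have e1 : ((1 - Lᴴ * L) * V)ᴴ * ((1 - Lᴴ * L) * V) = Vᴴ * V - (L * V)ᴴ * (L * V) := by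
      have e2 : (1 - Lᴴ * L)ᴴ * (1 - Lᴴ * L) = 1 - Lᴴ * L := by
        have : Lᴴ * L * (Lᴴ * L) = Lᴴ * L := by
          rw [Matrix.mul_assoc, ← Matrix.mul_assoc L, hLL, Matrix.one_mul]
        simp only [conjTranspose_sub, conjTranspose_one, conjTranspose_mul,
          conjTranspose_conjTranspose, sub_mul, mul_sub, Matrix.one_mul, Matrix.mul_one, this]
        abel
      calc _ = Vᴴ * ((1 - Lᴴ * L)ᴴ * (1 - Lᴴ * L)) * V := by
              simp only [conjTranspose_mul, Matrix.mul_assoc]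
        _ = _ := by
              rw [e2]
              simp only [mul_sub, sub_mul, Matrix.mul_one, conjTranspose_mul, Matrix.mul_assoc]
    rw [e1, hLV, hVV, hj, two_smul]
    abel
  have hpsd : ((2 : ℂ) • ((fromCols a b)ᴴ * fromCols a b) - jMat p).PosSemidef := by
    rw [key]
    exact (posSemidef_conjTranspose_mul_self _).add (posSemidef_conjTranspose_mul_self _)
  rw [hpsd.posDef_iff_isUnit]
  refine IsUnit.of_mul_eq_one (jMat p * ((2 : ℂ) • ((fromCols a b)ᴴ * fromCols a b) - jMat p) *
    jMat p) ?_
  rw [← Matrix.mul_assoc, ← Matrix.mul_assoc, hC, jMat_mul_self]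

/-- The only property of `t^{-1/2}` that the proof uses. -/
theorem invSqrt_conjTranspose_mul_self {t : Matrix (Fin p) (Fin p) ℂ} (ht : t.PosDef) :
    (invSqrt t)ᴴ * invSqrt t = t⁻¹ := by
  have hc (f : ℝ → ℝ) : ContinuousOn f (spectrum ℝ t) := t.finite_real_spectrum.continuousOn f
  have hsa : IsSelfAdjoint t := ht.isHermitian
  have hH : (invSqrt t)ᴴ = invSqrt t := cfc_predicate (R := ℝ) (p := IsSelfAdjoint) _ t
  rw [hH]
  refine (inv_eq_right_inv ?_).symm
  have h1 : cfc (fun x : ℝ => x * (x ^ (-(1 / 2) : ℝ) * x ^ (-(1 / 2) : ℝ))) t = 1 := by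
    rw [← cfc_one ℝ t]
    refine cfc_congr fun x hx => ?_
    rw [ht.isHermitian.spectrum_real_eq_range_eigenvalues] at hx
    obtain ⟨i, rfl⟩ := hx
    have hpos := ht.eigenvalues_pos i
    simp only [Pi.one_apply]
    rw [← Real.rpow_add hpos, show (-(1 / 2) + -(1 / 2) : ℝ) = -1 by norm_num,
      Real.rpow_neg_one, mul_inv_cancel₀ hpos.ne']
  rw [cfc_mul _ _ t (hc _) (hc _), cfc_mul _ _ t (hc _) (hc _), cfc_id' ℝ t] at h1
  exact h1

theorem exists_eq_conjTranspose_mul_self {t : Matrix (Fin p) (Fin p) ℂ} (ht : t.PosDef) :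
    ∃ g : Matrix (Fin p) (Fin p) ℂ, IsUnit g.det ∧ t = gᴴ * g := by
  have h := invSqrt_conjTranspose_mul_self ht.inv
  rw [nonsing_inv_nonsing_inv _ ((isUnit_iff_isUnit_det _).mp ht.isUnit)] at h
  refine ⟨_, ?_, h.symm⟩
  have h2 := (isUnit_iff_isUnit_det _).mp ht.isUnit
  rw [← h, det_mul] at h2
  exact isUnit_of_mul_isUnit_right h2

theorem exists_eq_two_smul_sub_jMat {C : Mat2 p} (hC : C.PosDef) (h : C * jMat p * C = jMat p) :
    ∃ γ : Matrix (Fin p) (Fin p ⊕ Fin p) ℂ, γ * jMat p * γᴴ = 1 ∧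
      C = (2 : ℂ) • (γᴴ * γ) - jMat p := by
  obtain ⟨a, b, c, d, rfl⟩ : ∃ a b c d, C = fromBlocks a b c d :=
    ⟨_, _, _, _, (fromBlocks_toBlocks C).symm⟩
  have hH := hC.isHermitian
  have ha : a.PosDef := hC.submatrix (e := Sum.inl) Sum.inl_injective
  have hd : d.PosDef := hC.submatrix (e := Sum.inr) Sum.inr_injective
  rw [isHermitian_fromBlocks_iff] at hH
  obtain ⟨-, hbc, -, -⟩ := hH
  simp only [jMat, fromBlocks_multiply, fromBlocks_inj, Matrix.mul_one, Matrix.mul_zero,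
    Matrix.mul_neg, Matrix.neg_mul, add_zero, zero_add] at h
  obtain ⟨h1, h2, h3, h4⟩ := h
  have hP : ((1 / 2 : ℂ) • (a + 1)).PosDef := (ha.add PosDef.one).smul (by norm_num [Complex.lt_def])
  have hd1 : (d + 1).PosDef := hd.add PosDef.one
  obtain ⟨g, hgu, hg⟩ := exists_eq_conjTranspose_mul_self hP
  have hgu' : IsUnit gᴴ.det := by rw [det_conjTranspose]; exact hgu.star
  have hg1 : gᴴ⁻¹ * gᴴ = 1 := nonsing_inv_mul _ hgu'
  have hg2 : g * g⁻¹ = 1 := mul_nonsing_inv _ hgu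
  have hg3 : g⁻¹ * g = 1 := nonsing_inv_mul _ hgu
  have hg4 : gᴴ * gᴴ⁻¹ = 1 := mul_nonsing_inv _ hgu'
  have hc : c = bᴴ := hbc.symm
  have hgi : (gᴴ⁻¹)ᴴ = g⁻¹ := by rw [← conjTranspose_nonsing_inv, conjTranspose_conjTranspose]
  have hgg : (g⁻¹ * gᴴ⁻¹) = ((1 / 2 : ℂ) • (a + 1))⁻¹ := by rw [hg, Matrix.mul_inv_rev]
  -- The first block row of `γ^*γ = (C + j)/2` forces this choice once `g^*g = (a + 1)/2`.
  refine ⟨fromCols g (gᴴ⁻¹ * ((1 / 2 : ℂ) • b)), ?_, ?_⟩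
  · have h5 : (1 / 4 : ℂ) • (b * c) = gᴴ * (g * gᴴ - 1) * g := by
      have : gᴴ * (g * gᴴ - 1) * g = (gᴴ * g) * (gᴴ * g) - gᴴ * g := by noncomm_ring
      rw [this, ← hg]
      have h6 : b * c = a * a - 1 := by rw [← h1]; abel
      rw [h6]
      simp only [smul_mul_smul_comm, add_mul, mul_add, Matrix.one_mul, Matrix.mul_one]
      module
    simp only [jMat, fromCols_mul_fromBlocks, conjTranspose_fromCols_eq_fromRows_conjTranspose,
      fromCols_mul_fromRows, Matrix.mul_one, Matrix.mul_zero, Matrix.mul_neg, Matrix.neg_mul,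
      add_zero, zero_add, conjTranspose_mul, hgi, conjTranspose_smul, ← hc]
    have h7 : gᴴ⁻¹ * ((1 / 2 : ℂ) • b) * (star (1 / 2 : ℂ) • c * g⁻¹) =
        gᴴ⁻¹ * ((1 / 4 : ℂ) • (b * c)) * g⁻¹ := by
      simp only [mul_smul_comm, smul_mul_assoc, smul_smul, Matrix.mul_assoc]
      congr 1; norm_num
    rw [h7, h5, ← Matrix.mul_assoc, ← Matrix.mul_assoc, hg1, Matrix.one_mul, Matrix.mul_assoc, hg2,
      Matrix.mul_one]
    abel
  -- The lower right corner is the only one not built in: `CjC = j` gives `(a + 1)b = b(d + 1)` and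
  -- `cb = d² - 1`.
  · have h8 : c * (a + 1)⁻¹ * b = d - 1 := by
      have hb : (a + 1)⁻¹ * b = b * (d + 1)⁻¹ := by
        have ha1 := (isUnit_iff_isUnit_det _).mp (ha.add PosDef.one).isUnit
        have hd2 := (isUnit_iff_isUnit_det _).mp hd1.isUnit
        have e : (a + 1) * b = b * (d + 1) := by
          rw [add_mul, mul_add, Matrix.one_mul, Matrix.mul_one, add_left_inj]
          exact add_neg_eq_zero.mp h2
        calc (a + 1)⁻¹ * b = (a + 1)⁻¹ * (b * (d + 1)) * (d + 1)⁻¹ := by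
              rw [← Matrix.mul_assoc, mul_nonsing_inv_cancel_right _ _ hd2]
          _ = b * (d + 1)⁻¹ := by rw [← e, nonsing_inv_mul_cancel_left _ _ ha1]
      have hd2 := (isUnit_iff_isUnit_det _).mp hd1.isUnit
      have e : c * b = (d - 1) * (d + 1) := by
        rw [eq_sub_of_add_eq h4]
        noncomm_ring
      rw [Matrix.mul_assoc, hb, ← Matrix.mul_assoc, e, mul_nonsing_inv_cancel_right _ _ hd2]
    have h9 : ((1 / 2 : ℂ) • (a + 1))⁻¹ = (2 : ℂ) • (a + 1)⁻¹ := by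
      refine inv_eq_right_inv ?_
      rw [smul_mul_smul_comm, mul_nonsing_inv _
        ((isUnit_iff_isUnit_det _).mp (ha.add PosDef.one).isUnit)]
      norm_num
    have h10 : gᴴ * (gᴴ⁻¹ * ((1 / 2 : ℂ) • b)) = (1 / 2 : ℂ) • b := by
      rw [← Matrix.mul_assoc, hg4, Matrix.one_mul]
    have h11 : star (1 / 2 : ℂ) • c * g⁻¹ * g = (1 / 2 : ℂ) • c := by
      rw [Matrix.mul_assoc, hg3, Matrix.mul_one]; norm_num
    have h12 : star (1 / 2 : ℂ) • c * g⁻¹ * (gᴴ⁻¹ * ((1 / 2 : ℂ) • b)) = (1 / 2 : ℂ) • (d - 1) := by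
      calc _ = star (1 / 2 : ℂ) • c * (g⁻¹ * gᴴ⁻¹) * ((1 / 2 : ℂ) • b) := by
            simp only [Matrix.mul_assoc]
        _ = _ := by
            rw [hgg, h9, ← h8]
            simp only [mul_smul_comm, smul_mul_assoc, smul_smul]
            congr 1; norm_num
    rw [conjTranspose_fromCols_eq_fromRows_conjTranspose, fromRows_mul_fromCols, conjTranspose_mul,
      conjTranspose_smul, hgi, ← hc, ← hg, h10, h11, h12, fromBlocks_smul, jMat]
    ext (i | i) (k | k) <;> simp

end

/-! ### Subspaces in an indefinite inner product; recovering coefficients from solutions -/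

section

variable {p : ℕ}

/-- In the Gram matrix of the stacked rows, the Schur complement of the positive corner is negative
definite, so the Gram matrix is invertible. -/
theorem isUnit_det_fromRows {X Y : Matrix (Fin p) (Fin p ⊕ Fin p) ℂ} {J : Mat2 p}
    (hJ : J.IsHermitian) (hX : (X * J * Xᴴ).PosDef) (hY : (-(Y * J * Yᴴ)).PosDef) :
    IsUnit (fromRows X Y).det := by
  have e : fromRows X Y * J * (fromRows X Y)ᴴ =
      fromBlocks (X * J * Xᴴ) (X * J * Yᴴ) (Y * J * Xᴴ) (Y * J * Yᴴ) := by
    rw [conjTranspose_fromRows_eq_fromCols_conjTranspose, fromRows_mul, fromRows_mul_fromCols]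
  have hs : (Y * J * Xᴴ) = (X * J * Yᴴ)ᴴ := by
    simp only [conjTranspose_mul, conjTranspose_conjTranspose, hJ.eq, Matrix.mul_assoc]
  let := hX.isUnit.invertible
  have hu : IsUnit (fromRows X Y * J * (fromRows X Y)ᴴ) := by
    rw [e, isUnit_fromBlocks_iff_of_invertible₁₁, ← IsUnit.neg_iff, neg_sub, hs, invOf_eq_nonsing_inv,
      sub_eq_add_neg]
    exact (hY.posSemidef_add (hX.inv.posSemidef.conjTranspose_mul_mul_same _)).isUnit
  rw [isUnit_iff_isUnit_det, det_mul, det_mul, mul_assoc] at hu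
  exact isUnit_of_mul_isUnit_left hu

theorem add_mul_eq_fromCols_mul_fromRows (X Y : Matrix (Fin p) (Fin p ⊕ Fin p) ℂ)
    (σ : Matrix (Fin p) (Fin p) ℂ) : X + σ * Y = fromCols (1 : Matrix (Fin p) (Fin p) ℂ) σ * fromRows X Y := by
  rw [fromCols_mul_fromRows, Matrix.one_mul]

/-- A positive matrix of the form `(X + σY)ᴴ t (X + σY)` determines `t` and `σ`. -/
theorem eq_of_conjTranspose_mul_mul_eq {X Y : Matrix (Fin p) (Fin p ⊕ Fin p) ℂ}
    (hD : IsUnit (fromRows X Y).det) {t t' σ σ' : Matrix (Fin p) (Fin p) ℂ} (ht : IsUnit t.det)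
    (h : (X + σ * Y)ᴴ * t * (X + σ * Y) = (X + σ' * Y)ᴴ * t' * (X + σ' * Y)) :
    t = t' ∧ σ = σ' := by
  have hD' : IsUnit (fromRows X Y)ᴴ.det := by rw [det_conjTranspose]; exact hD.star
  simp only [add_mul_eq_fromCols_mul_fromRows, conjTranspose_mul] at h
  simp only [Matrix.mul_assoc] at h
  have h := ((isUnit_iff_isUnit_det _).mpr hD').mul_right_injective h
  simp only [← Matrix.mul_assoc] at h
  have h := ((isUnit_iff_isUnit_det _).mpr hD).mul_left_injective h
  simp only [conjTranspose_fromCols_eq_fromRows_conjTranspose, fromRows_mul, mul_fromCols,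
    fromCols_fromRows_eq_fromBlocks, conjTranspose_one, Matrix.one_mul, Matrix.mul_one, fromBlocks_inj] at h
  obtain ⟨rfl, h2, -, -⟩ := h
  exact ⟨rfl, ((isUnit_iff_isUnit_det _).mpr ht).mul_right_injective h2⟩

/-- A positive maximal subspace is a graph over `X` when `Y` is nonpositive. -/
theorem exists_eq_mul_add_mul {X Y γ : Matrix (Fin p) (Fin p ⊕ Fin p) ℂ} {J : Mat2 p}
    (hD : IsUnit (fromRows X Y).det) (hY : (-(Y * J * Yᴴ)).PosSemidef) (hγ : γ * J * γᴴ = 1) :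
    ∃ A σ : Matrix (Fin p) (Fin p) ℂ, IsUnit A.det ∧ γ = A * (X + σ * Y) := by
  obtain ⟨A, B, hAB⟩ : ∃ A B, γ * (fromRows X Y)⁻¹ = fromCols A B :=
    ⟨_, _, (fromCols_toCols _).symm⟩
  have hγ' : γ = A * X + B * Y := by
    rw [← fromCols_mul_fromRows, ← hAB, nonsing_inv_mul_cancel_right _ _ hD]
  have hA : IsUnit A.det := by
    rw [isUnit_iff_ne_zero]
    -- If `vA = 0`, then `vγ = vBY`, so `vv^* = (vB) YJY^* (vB)^* ≤ 0` and `v = 0`.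
    intro h0
    obtain ⟨v, hv, hvA⟩ := exists_vecMul_eq_zero_iff.mpr h0
    set V : Matrix Unit (Fin p) ℂ := replicateRow Unit v with hV
    have hVA : V * A = 0 := by
      rw [hV, ← replicateRow_vecMul, hvA]; rfl
    have e : -(V * Vᴴ) = (V * B) * (-(Y * J * Yᴴ)) * (V * B)ᴴ := by
      have : V * Vᴴ = (V * γ) * J * (V * γ)ᴴ := by
        calc V * Vᴴ = V * (γ * J * γᴴ) * Vᴴ := by rw [hγ, Matrix.mul_one]
          _ = _ := by simp only [conjTranspose_mul, Matrix.mul_assoc]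
      have h2 : V * γ = V * B * Y := by
        rw [hγ', Matrix.mul_add, ← Matrix.mul_assoc, hVA, Matrix.zero_mul, zero_add,
          Matrix.mul_assoc]
      rw [this, h2]
      simp only [conjTranspose_mul, Matrix.mul_assoc, Matrix.mul_neg, Matrix.neg_mul]
    have h1 : 0 ≤ (-(V * Vᴴ)).trace := by
      rw [e]; exact (hY.mul_mul_conjTranspose_same _).trace_nonneg
    have h2 := (posSemidef_self_mul_conjTranspose V).trace_nonneg
    rw [trace_neg] at h1
    have h3 := trace_mul_conjTranspose_self_eq_zero_iff.mp (le_antisymm (neg_nonneg.mp h1) h2)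
    exact hv (funext fun i => congrFun (congrFun h3 ()) i)
  refine ⟨A, A⁻¹ * B, hA, ?_⟩
  rw [Matrix.mul_add, ← Matrix.mul_assoc, mul_nonsing_inv_cancel_left _ _ hA, hγ']

/-- `(jC)² = 1`, so `(1 - i jC)(1 + i jC) = 2`. -/
theorem isUnit_one_sub_I_smul_jMat_mul {C : Mat2 p} (h : C * jMat p * C = jMat p) :
    IsUnit (1 - Complex.I • (jMat p * C)) := by
  have h2 : (jMat p * C) * (jMat p * C) = 1 := by
    rw [Matrix.mul_assoc, ← Matrix.mul_assoc C, h, jMat_mul_self]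
  refine IsUnit.of_mul_eq_one ((1 / 2 : ℂ) • (1 + Complex.I • (jMat p * C))) ?_
  simp only [mul_smul_comm, sub_mul, mul_add, smul_mul_assoc, smul_smul, h2, Matrix.one_mul,
    Matrix.mul_one, smul_add, smul_sub]
  rw [mul_assoc (1 / 2 : ℂ), Complex.I_mul_I]
  module

/-- The solution with `W_0 = 1` is invertible at `z = 1` for every `k`, so the recurrence can be
solved for `C_k` there. -/
theorem diracSystem_injOn (p n : ℕ) :
    Set.InjOn (diracSystem (p := p) (n := n)) (diracPotentials p n) := by
  intro C hC C' _ h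
  let W : Fin (n + 1) → ℂ → Mat2 p := fun k z =>
    Fin.induction (motive := fun _ => Mat2 p) 1
      (fun i w => w - (Complex.I / z) • (jMat p * C i * w)) k
  have hW (k : Fin n) (z : ℂ) :
      W k.succ z = W k.castSucc z - (Complex.I / z) • (jMat p * C k * W k.castSucc z) := rfl
  have hmem : W ∈ diracSystem C := by
    intro k z _
    rw [hW, neg_smul]
    abel
  have hunit (k : Fin (n + 1)) : IsUnit (W k 1) := by
    induction k using Fin.induction with
    | zero => exact isUnit_one
    | succ k ih =>
      rw [hW, div_one, ← smul_mul_assoc]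
      nth_rewrite 1 [← Matrix.one_mul (W k.castSucc 1)]
      rw [← sub_mul]
      exact (isUnit_one_sub_I_smul_jMat_mul (hC k).2).mul ih
  have hmem' : W ∈ diracSystem C' := h ▸ hmem
  funext k
  have e := (hmem k 1 one_ne_zero).symm.trans (hmem' k 1 one_ne_zero)
  have e2 := smul_right_injective _ (by simp : -(Complex.I / 1) ≠ 0) e
  have e3 := (hunit k.castSucc).mul_left_injective e2
  have hj : IsUnit (jMat p) := IsUnit.of_mul_eq_one _ jMat_mul_self
  exact hj.mul_right_injective e3

end

/-! ### Block Toeplitz matrices and the displacement identity -/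

section

variable {p : ℕ}

/-- The block Toeplitz matrix `{s_{j-i}}` with `m × m` blocks. -/
def toeplitz (s : ℤ → Matrix (Fin p) (Fin p) ℂ) (m : ℕ) : BlockMatrix p m :=
  Matrix.of fun x y => s ((y.1 : ℤ) - (x.1 : ℤ)) x.2 y.2

/-- `s_{-k} = s_k^*`. -/
def IsHermitianSeq (s : ℤ → Matrix (Fin p) (Fin p) ℂ) : Prop := ∀ k, s (-k) = (s k)ᴴ

/-- The block row `[s_{-m} … s_{-1}]` below `toeplitz s m`. -/
def lowerRow (s : ℤ → Matrix (Fin p) (Fin p) ℂ) (m : ℕ) : Matrix (Fin p) (Fin m × Fin p) ℂ :=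
  Matrix.of fun a y => s ((y.1 : ℤ) - m) a y.2

/-- The block row `[s_1 … s_m]` above `toeplitz s m`. -/
def upperRow (s : ℤ → Matrix (Fin p) (Fin p) ℂ) (m : ℕ) : Matrix (Fin p) (Fin m × Fin p) ℂ :=
  Matrix.of fun a y => s ((y.1 : ℤ) + 1) a y.2

/-- The last block `s_0/2 + s_{-1} + … + s_{-m} + iν` of `Φ₂`. -/
noncomputable def phi (s : ℤ → Matrix (Fin p) (Fin p) ℂ) (ν : Matrix (Fin p) (Fin p) ℂ) (m : ℕ) :
    Matrix (Fin p) (Fin p) ℂ :=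
  (1 / 2 : ℂ) • s 0 + ∑ l ∈ Finset.range m, s (-((l : ℤ) + 1)) + Complex.I • ν

/-- `[Φ₁ Φ₂]`. -/
noncomputable def phiCols (s : ℤ → Matrix (Fin p) (Fin p) ℂ) (ν : Matrix (Fin p) (Fin p) ℂ)
    (m : ℕ) : Matrix (Fin m × Fin p) (Fin p ⊕ Fin p) ℂ :=
  fromCols (Phi1 p m) (Matrix.of fun x b => phi s ν x.1 x.2 b)

/-- The last block is split off. -/
def splitLast (p m : ℕ) : (Fin m × Fin p) ⊕ Fin p ≃ Fin (m + 1) × Fin p where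
  toFun := Sum.elim (fun x => (x.1.castSucc, x.2)) (fun a => (Fin.last m, a))
  invFun x := Fin.lastCases (motive := fun _ => (Fin m × Fin p) ⊕ Fin p) (Sum.inr x.2)
    (fun i => Sum.inl (i, x.2)) x.1
  left_inv x := by rcases x with x | a <;> simp
  right_inv x := by
    obtain ⟨i, a⟩ := x
    induction i using Fin.lastCases <;> simp

/-- The first block is split off. -/
def splitFirst (p m : ℕ) : Fin p ⊕ (Fin m × Fin p) ≃ Fin (m + 1) × Fin p where
  toFun := Sum.elim (fun a => (0, a)) (fun x => (x.1.succ, x.2))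
  invFun x := Fin.cases (motive := fun _ => Fin p ⊕ (Fin m × Fin p)) (Sum.inl x.2)
    (fun i => Sum.inr (i, x.2)) x.1
  left_inv x := by rcases x with x | a <;> simp
  right_inv x := by
    obtain ⟨i, a⟩ := x
    induction i using Fin.cases <;> simp

variable {s : ℤ → Matrix (Fin p) (Fin p) ℂ} {ν : Matrix (Fin p) (Fin p) ℂ}

theorem toeplitz_isHermitian (hs : IsHermitianSeq s) (m : ℕ) : (toeplitz s m).IsHermitian := by
  ext x y
  have := congrFun (congrFun (hs ((y.1 : ℤ) - x.1)) y.2) x.2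
  simp only [toeplitz, conjTranspose_apply, of_apply] at this ⊢
  rw [← neg_sub, this, star_star]

theorem toeplitz_submatrix_splitLast (hs : IsHermitianSeq s) (m : ℕ) :
    (toeplitz s (m + 1)).submatrix (splitLast p m) (splitLast p m) =
      fromBlocks (toeplitz s m) (lowerRow s m)ᴴ (lowerRow s m) (s 0) := by
  ext (x | a) (y | b)
  · simp [toeplitz, splitLast]
  · have := congrFun (congrFun (hs ((x.1 : ℤ) - m)) x.2) b
    simp only [neg_sub] at this
    simp [toeplitz, splitLast, lowerRow, this]
  · simp [toeplitz, splitLast, lowerRow]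
  · simp [toeplitz, splitLast]

theorem toeplitz_submatrix_splitFirst (hs : IsHermitianSeq s) (m : ℕ) :
    (toeplitz s (m + 1)).submatrix (splitFirst p m) (splitFirst p m) =
      fromBlocks (s 0) (upperRow s m) (upperRow s m)ᴴ (toeplitz s m) := by
  ext (x | a) (y | b)
  · simp [toeplitz, splitFirst]
  · simp [toeplitz, splitFirst, upperRow]
  · have := congrFun (congrFun (hs ((a.1 : ℤ) + 1)) a.2) y
    simpa [toeplitz, splitFirst, upperRow, -neg_add_rev] using this
  · simp [toeplitz, splitFirst]

theorem phiCols_submatrix_splitLast (m : ℕ) :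
    (phiCols s ν (m + 1)).submatrix (splitLast p m) id =
      fromRows (phiCols s ν m) (fromCols 1 (phi s ν m)) := by
  ext (x | a) (y | b) <;> simp [phiCols, splitLast, Phi1]

/-- Half the identity on the block diagonal and `I_p` below it. -/
noncomputable def halfSum (p m : ℕ) : BlockMatrix p m :=
  Matrix.of fun x y => if x.2 = y.2 then
    (if y.1 < x.1 then 1 else if y.1 = x.1 then 1 / 2 else 0) else 0

theorem sum_fin_lt {m : ℕ} (i : Fin m) (g : ℕ → ℂ) :
    ∑ l : Fin m, (if l < i then g l else 0) = ∑ l ∈ Finset.range i, g l := by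
  simp only [Fin.lt_def]
  rw [Fin.sum_univ_eq_sum_range (fun l => if l < (i : ℕ) then g l else 0) m, ← Finset.sum_filter]
  congr 1
  ext l
  have := i.isLt
  simp only [Finset.mem_filter, Finset.mem_range]
  lia

theorem halfSum_mul_apply {κ : Type*} (m : ℕ) (A : Matrix (Fin m × Fin p) κ ℂ) (x y) :
    (halfSum p m * A) x y =
      (1 / 2) * A x y + ∑ l : Fin m, if l < x.1 then A (l, x.2) y else 0 := by
  rw [mul_apply, Fintype.sum_prod_type]
  simp only [halfSum, of_apply, ite_mul, one_mul, zero_mul, Finset.sum_ite_eq, Finset.mem_univ,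
    if_true]
  have h (l : Fin m) : (if l < x.1 then A (l, x.2) y else
      if l = x.1 then 1 / 2 * A (l, x.2) y else 0) =
      (if l = x.1 then 1 / 2 * A (l, x.2) y else 0) + if l < x.1 then A (l, x.2) y else 0 := by
    by_cases h1 : l = x.1
    · simp [h1]
    · simp [h1]
  simp only [h, Finset.sum_add_distrib, Finset.sum_ite_eq', Finset.mem_univ, if_true]

/-- Both sides are the sum of `f` over the integers from `-i` to `j`. -/
theorem sum_range_toeplitz (f : ℤ → ℂ) (i j : ℕ) :
    f ((j : ℤ) - i) + ∑ l ∈ Finset.range i, f ((j : ℤ) - l) + ∑ l ∈ Finset.range j, f ((l : ℤ) - i) =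
      f 0 + ∑ l ∈ Finset.range i, f (-((l : ℤ) + 1)) + ∑ l ∈ Finset.range j, f ((l : ℤ) + 1) := by
  induction j with
  | zero =>
    have := Finset.sum_range_succ' (fun l : ℕ => f (-(l : ℤ))) i
    rw [Finset.sum_range_succ] at this
    simp at this ⊢
    linear_combination this
  | succ j ih =>
    rw [Finset.sum_range_succ, Finset.sum_range_succ]
    have := Finset.sum_range_succ' (fun l : ℕ => f ((j : ℤ) + 1 - l)) i
    rw [Finset.sum_range_succ] at this
    have e (l : ℕ) : (j : ℤ) + 1 - (l + 1) = j - l := by ring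
    simp only [Nat.cast_add, Nat.cast_one, Nat.cast_zero, sub_zero, e] at this ⊢
    linear_combination this + ih

/-- In block position `(x, y)` both sides are the sum of `s_u` over `-x ≤ u ≤ y`; the terms `iν`
cancel because `ν = ν^*`. -/
theorem halfSum_mul_toeplitz (hs : IsHermitianSeq s) (hν : ν.IsHermitian) (m : ℕ) :
    halfSum p m * toeplitz s m + toeplitz s m * (halfSum p m)ᴴ =
      phiCols s ν m * swapMat p * (phiCols s ν m)ᴴ := by
  have hT : toeplitz s m * (halfSum p m)ᴴ = (halfSum p m * toeplitz s m)ᴴ := by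
    rw [conjTranspose_mul, (toeplitz_isHermitian hs m).eq]
  have hBT (x y : Fin m × Fin p) : (halfSum p m * toeplitz s m) x y =
      1 / 2 * s ((y.1 : ℤ) - x.1) x.2 y.2 +
        ∑ l ∈ Finset.range x.1, s ((y.1 : ℤ) - l) x.2 y.2 := by
    rw [halfSum_mul_apply]
    simp only [toeplitz, of_apply]
    rw [sum_fin_lt x.1 (fun l => s ((y.1 : ℤ) - l) x.2 y.2)]
  have hstar (k : ℤ) (a b : Fin p) : star (s k b a) = s (-k) a b := by
    rw [hs, conjTranspose_apply]
  have hνs (a b : Fin p) : star (ν b a) = ν a b := by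
    rw [← conjTranspose_apply, hν.eq]
  rw [hT]
  ext x y
  have hR : (phiCols s ν m * swapMat p * (phiCols s ν m)ᴴ) x y =
      phi s ν x.1 x.2 y.2 + star (phi s ν y.1 y.2 x.2) := by
    rw [phiCols, swapMat, fromCols_mul_fromBlocks,
      conjTranspose_fromCols_eq_fromRows_conjTranspose, fromCols_mul_fromRows]
    simp [Phi1, mul_apply, one_apply]
  rw [hR, Matrix.add_apply, conjTranspose_apply, hBT, hBT]
  simp only [phi, Matrix.add_apply, Matrix.smul_apply, Matrix.sum_apply, star_add, star_mul',
    star_sum, smul_eq_mul, hstar, hνs, neg_sub, neg_neg, neg_zero]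
  have h := sum_range_toeplitz (fun k => s k x.2 y.2) x.1 y.1
  have hI : star Complex.I = -Complex.I := Complex.conj_I
  have h2 : star (1 / 2 : ℂ) = 1 / 2 := by simp
  rw [hI, h2]
  linear_combination h

theorem sum_Ioc_fin {m : ℕ} (i : Fin (m + 1)) (g : ℕ → ℂ) :
    ∑ l ∈ Finset.Ioc 0 i, g l = ∑ l ∈ Finset.range i, g (l + 1) := by
  have h : Finset.Ioc 0 i = Finset.univ.filter fun l : Fin (m + 1) => 0 < (l : ℕ) ∧ (l : ℕ) ≤ i := by
    ext l
    simp only [Finset.mem_Ioc, Finset.mem_filter, Finset.mem_univ, true_and, Fin.lt_def,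
      Fin.le_def, Fin.val_zero]
  rw [h, Finset.sum_filter,
    Fin.sum_univ_eq_sum_range (fun l => if 0 < l ∧ l ≤ (i : ℕ) then g l else 0) (m + 1),
    Finset.sum_range_succ']
  simp only [lt_irrefl, false_and, if_false, add_zero]
  rw [← Finset.sum_filter]
  congr 1
  ext l
  have := i.isLt
  simp only [Finset.mem_filter, Finset.mem_range]
  lia

theorem fromCols_phi1_phi2_toeplitz (m : ℕ) :
    fromCols (Phi1 p (m + 1)) (Phi2 (toeplitz s (m + 1)) ν) = phiCols s ν (m + 1) := by
  rw [phiCols]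
  congr 1
  ext x b
  simp only [Phi2, phi, of_apply, Matrix.add_apply, Matrix.smul_apply, Matrix.sum_apply, block,
    toeplitz, Fin.val_zero, Nat.cast_zero, zero_sub, sub_self]
  rw [sum_Ioc_fin x.1 (fun l => s (-(l : ℤ)) x.2 b)]
  simp only [Nat.cast_add, Nat.cast_one]

/-! ### Schur complements and `β(k)` -/

/-- The Schur complement `s_0 - u T⁻¹ u^*` of `toeplitz s m` in `toeplitz s (m + 1)`. -/
noncomputable def schur (s : ℤ → Matrix (Fin p) (Fin p) ℂ) (m : ℕ) : Matrix (Fin p) (Fin p) ℂ :=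
  s 0 - lowerRow s m * (toeplitz s m)⁻¹ * (lowerRow s m)ᴴ

/-- `[-u T⁻¹ I_p] [Φ₁ Φ₂]`. -/
noncomputable def schurRow (s : ℤ → Matrix (Fin p) (Fin p) ℂ) (ν : Matrix (Fin p) (Fin p) ℂ)
    (m : ℕ) : Matrix (Fin p) (Fin p ⊕ Fin p) ℂ :=
  fromCols 1 (phi s ν m) - lowerRow s m * (toeplitz s m)⁻¹ * phiCols s ν m

/-- `[-u T⁻¹ I_p]`. -/
noncomputable def elimRow (s : ℤ → Matrix (Fin p) (Fin p) ℂ) (m : ℕ) :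
    Matrix (Fin p) (Fin (m + 1) × Fin p) ℂ :=
  (fromCols (-(lowerRow s m * (toeplitz s m)⁻¹)) 1).submatrix id (splitLast p m).symm

theorem mul_eq_submatrix_mul_submatrix {α β γ δ : Type*} [Fintype β] [Fintype γ] (A : Matrix α β ℂ)
    (B : Matrix β δ ℂ) (e : γ ≃ β) : A * B = A.submatrix id e * B.submatrix e id := by
  rw [submatrix_mul_equiv, submatrix_id_id]

theorem elimRow_mul_phiCols (m : ℕ) : elimRow s m * phiCols s ν (m + 1) = schurRow s ν m := by
  rw [mul_eq_submatrix_mul_submatrix _ _ (splitLast p m), phiCols_submatrix_splitLast, elimRow,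
    submatrix_submatrix]
  simp only [Function.comp_id, Equiv.symm_comp_self, submatrix_id_id, fromCols_mul_fromRows,
    Matrix.one_mul, Matrix.neg_mul, schurRow]
  abel

theorem lastRow_submatrix (m : ℕ) :
    (lastRow p m).submatrix id (splitLast p m) = fromCols 0 1 := by
  ext a (x | b)
  · simp [lastRow, splitLast]
  · simp [lastRow, splitLast, one_apply, eq_comm]

theorem elimRow_mul_lastRow (m : ℕ) : elimRow s m * (lastRow p m)ᴴ = 1 := by
  rw [mul_eq_submatrix_mul_submatrix _ _ (splitLast p m), ← conjTranspose_submatrix,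
    lastRow_submatrix, elimRow, submatrix_submatrix]
  simp only [Function.comp_id, Equiv.symm_comp_self, submatrix_id_id, fromCols_mul_fromRows,
    conjTranspose_fromCols_eq_fromRows_conjTranspose, conjTranspose_one, Matrix.one_mul,
    conjTranspose_zero, Matrix.mul_zero, zero_add]

/-- Block elimination clears everything but the last block. This identifies the last block row of
the inverse of `toeplitz s (m + 1)` as `δ⁻¹[-uT⁻¹ I]`. -/
theorem elimRow_mul_toeplitz (hs : IsHermitianSeq s) {m : ℕ} (hT : (toeplitz s m).PosDef) :
    elimRow s m * toeplitz s (m + 1) = schur s m * lastRow p m := by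
  have h : (elimRow s m * toeplitz s (m + 1)).submatrix id (splitLast p m) =
      (schur s m * lastRow p m).submatrix id (splitLast p m) := by
    rw [← submatrix_mul_equiv _ _ _ (splitLast p m), toeplitz_submatrix_splitLast hs,
      submatrix_mul _ _ _ id _ Function.bijective_id, lastRow_submatrix, elimRow,
      submatrix_submatrix]
    simp only [Function.comp_id, Equiv.symm_comp_self, submatrix_id_id, fromCols_mul_fromBlocks,
      Matrix.neg_mul, Matrix.one_mul, mul_fromCols, Matrix.mul_zero, Matrix.mul_one]
    rw [nonsing_inv_mul_cancel_right _ _ ((isUnit_iff_isUnit_det _).mp hT.isUnit), schur]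
    congr 1 <;> abel
  have h2 := congrArg (fun A => A.submatrix id (splitLast p m).symm) h
  simpa only [submatrix_submatrix, Function.comp_id, Equiv.self_comp_symm, submatrix_id_id] using h2

theorem halfSum_mul_lastRow (m : ℕ) :
    halfSum p (m + 1) * (lastRow p m)ᴴ = (1 / 2 : ℂ) • (lastRow p m)ᴴ := by
  ext x a
  rw [halfSum_mul_apply]
  simp only [lastRow, conjTranspose_apply, of_apply, Matrix.smul_apply, smul_eq_mul]
  rw [Finset.sum_eq_zero, add_zero]
  intro l _
  split_ifs with h1 h2
  · exact absurd (h2.1 ▸ h1) (not_lt.mpr (Fin.le_last _))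
  · simp
  · rfl

theorem schur_isHermitian (hs : IsHermitianSeq s) (m : ℕ) : (schur s m).IsHermitian := by
  have h0 : (s 0)ᴴ = s 0 := by rw [← hs, neg_zero]
  rw [IsHermitian, schur, conjTranspose_sub, h0]
  simp only [conjTranspose_mul, conjTranspose_conjTranspose, conjTranspose_nonsing_inv,
    (toeplitz_isHermitian hs m).eq, Matrix.mul_assoc]

/-- The displacement identity compressed by `elimRow`: the last block column of `halfSum` is half a
unit column, so each of the two terms on the left contributes `δ/2`. -/
theorem schurRow_mul_swapMat_mul (hs : IsHermitianSeq s) (hν : ν.IsHermitian) {m : ℕ}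
    (hT : (toeplitz s m).PosDef) :
    schurRow s ν m * swapMat p * (schurRow s ν m)ᴴ = schur s m := by
  have h1 : elimRow s m * (toeplitz s (m + 1) * (halfSum p (m + 1))ᴴ) * (elimRow s m)ᴴ =
      (1 / 2 : ℂ) • schur s m := by
    have : lastRow p m * (halfSum p (m + 1))ᴴ = (1 / 2 : ℂ) • lastRow p m := by
      have := congrArg conjTranspose (halfSum_mul_lastRow (p := p) m)
      simpa using this
    have h2 := congrArg conjTranspose (elimRow_mul_lastRow (s := s) m)
    rw [conjTranspose_mul, conjTranspose_conjTranspose, conjTranspose_one] at h2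
    rw [← Matrix.mul_assoc, elimRow_mul_toeplitz hs hT, Matrix.mul_assoc _ (lastRow p m), this,
      Matrix.mul_assoc, Matrix.smul_mul, h2, mul_smul_comm, Matrix.mul_one]
  have h2 : elimRow s m * (halfSum p (m + 1) * toeplitz s (m + 1)) * (elimRow s m)ᴴ =
      (1 / 2 : ℂ) • schur s m := by
    have := congrArg conjTranspose h1
    simp only [conjTranspose_mul, conjTranspose_conjTranspose, conjTranspose_smul,
      (toeplitz_isHermitian hs _).eq, (schur_isHermitian hs m).eq] at this
    rw [Matrix.mul_assoc, this]
    congr 1; norm_num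
  rw [← elimRow_mul_phiCols, conjTranspose_mul]
  calc _ = elimRow s m * (phiCols s ν (m + 1) * swapMat p * (phiCols s ν (m + 1))ᴴ) *
        (elimRow s m)ᴴ := by simp only [Matrix.mul_assoc]
    _ = _ := by
      rw [← halfSum_mul_toeplitz hs hν, Matrix.mul_add, Matrix.add_mul, h1, h2]
      module

theorem toeplitz_succ_posDef_iff (hs : IsHermitianSeq s) {m : ℕ} (hT : (toeplitz s m).PosDef) :
    (toeplitz s (m + 1)).PosDef ↔ (schur s m).PosDef := by
  let := hT.isUnit.invertible
  have h1 : (toeplitz s (m + 1)).PosSemidef ↔ (schur s m).PosSemidef := by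
    rw [← posSemidef_submatrix_equiv (splitLast p m), toeplitz_submatrix_splitLast hs]
    have := PosDef.fromBlocks₁₁ (lowerRow s m)ᴴ (s 0) hT
    rwa [conjTranspose_conjTranspose] at this
  have h2 : IsUnit (toeplitz s (m + 1)) ↔ IsUnit (schur s m) := by
    rw [isUnit_iff_isUnit_det, ← det_submatrix_equiv_self (splitLast p m),
      toeplitz_submatrix_splitLast hs, ← isUnit_iff_isUnit_det,
      isUnit_fromBlocks_iff_of_invertible₁₁, invOf_eq_nonsing_inv, schur]
  constructor
  · intro h
    exact (h1.mp h.posSemidef).posDef_iff_isUnit.mpr (h2.mp h.isUnit)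
  · intro h
    exact (h1.mpr h.posSemidef).posDef_iff_isUnit.mpr (h2.mpr h.isUnit)

theorem lastRow_mul_inv (hs : IsHermitianSeq s) {m : ℕ} (hT : (toeplitz s m).PosDef)
    (hT' : (toeplitz s (m + 1)).PosDef) :
    lastRow p m * (toeplitz s (m + 1))⁻¹ = (schur s m)⁻¹ * elimRow s m := by
  have hδ := (toeplitz_succ_posDef_iff hs hT).mp hT'
  have h := elimRow_mul_toeplitz hs hT
  have h2 : lastRow p m = (schur s m)⁻¹ * elimRow s m * toeplitz s (m + 1) := by
    rw [Matrix.mul_assoc, h, nonsing_inv_mul_cancel_left _ _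
      ((isUnit_iff_isUnit_det _).mp hδ.isUnit)]
  rw [h2, mul_nonsing_inv_cancel_right _ _ ((isUnit_iff_isUnit_det _).mp hT'.isUnit)]

theorem tMat_toeplitz (hs : IsHermitianSeq s) {m : ℕ} (hT : (toeplitz s m).PosDef)
    (hT' : (toeplitz s (m + 1)).PosDef) : tMat (toeplitz s (m + 1)) = (schur s m)⁻¹ := by
  rw [tMat, lastRow_mul_inv hs hT hT', Matrix.mul_assoc, elimRow_mul_lastRow, Matrix.mul_one]

theorem XY_toeplitz (hs : IsHermitianSeq s) {m : ℕ} (hT : (toeplitz s m).PosDef)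
    (hT' : (toeplitz s (m + 1)).PosDef) :
    XY (toeplitz s (m + 1)) ν = (schur s m)⁻¹ * schurRow s ν m := by
  rw [XY, lastRow_mul_inv hs hT hT', fromCols_phi1_phi2_toeplitz, Matrix.mul_assoc,
    elimRow_mul_phiCols]

theorem toeplitz_posDef_of_le {m n : ℕ} (h : m ≤ n) (hT : (toeplitz s n).PosDef) :
    (toeplitz s m).PosDef := by
  have : toeplitz s m = (toeplitz s n).submatrix (fun x => (Fin.castLE h x.1, x.2))
      (fun x => (Fin.castLE h x.1, x.2)) := rfl
  rw [this]
  refine hT.submatrix fun x y hxy => ?_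
  simpa [Prod.ext_iff] using hxy

theorem leading_toeplitz {n : ℕ} (k : Fin n) : leading (toeplitz s n) k = toeplitz s (k + 1) := rfl

/-- Since `t = δ⁻¹` and `[X Y] = δ⁻¹M`, the square roots combine to `δ` and disappear from `C_k`. -/
theorem beta_conjTranspose_mul_self (hs : IsHermitianSeq s) {n : ℕ} (hT : (toeplitz s n).PosDef)
    (k : Fin n) : (beta (toeplitz s n) ν k)ᴴ * beta (toeplitz s n) ν k =
      (schurRow s ν k)ᴴ * (schur s k)⁻¹ * schurRow s ν k := by
  have h1 := toeplitz_posDef_of_le k.isLt.le hT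
  have h2 : (toeplitz s (k + 1)).PosDef := toeplitz_posDef_of_le k.isLt hT
  have hδ := (toeplitz_succ_posDef_iff hs h1).mp h2
  have hu := (isUnit_iff_isUnit_det _).mp hδ.isUnit
  rw [beta, leading_toeplitz, tMat_toeplitz hs h1 h2, XY_toeplitz hs h1 h2, conjTranspose_mul]
  calc _ = ((schur s k)⁻¹ * schurRow s ν k)ᴴ *
        ((invSqrt (schur s k)⁻¹)ᴴ * invSqrt (schur s k)⁻¹) * ((schur s k)⁻¹ * schurRow s ν k) := by
        simp only [Matrix.mul_assoc]
    _ = _ := by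
        rw [invSqrt_conjTranspose_mul_self hδ.inv, nonsing_inv_nonsing_inv _ hu, conjTranspose_mul,
          conjTranspose_nonsing_inv, hδ.isHermitian.eq]
        simp only [Matrix.mul_assoc]
        rw [mul_nonsing_inv_cancel_left _ _ hu]

theorem beta_mul_swapMat_mul (hs : IsHermitianSeq s) (hν : ν.IsHermitian) {n : ℕ}
    (hT : (toeplitz s n).PosDef) (k : Fin n) :
    beta (toeplitz s n) ν k * swapMat p * (beta (toeplitz s n) ν k)ᴴ = 1 := by
  have h1 := toeplitz_posDef_of_le k.isLt.le hT
  have h2 : (toeplitz s (k + 1)).PosDef := toeplitz_posDef_of_le k.isLt hT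
  have hδ := (toeplitz_succ_posDef_iff hs h1).mp h2
  have hu := (isUnit_iff_isUnit_det _).mp hδ.isUnit
  have hg := invSqrt_conjTranspose_mul_self hδ.inv
  rw [nonsing_inv_nonsing_inv _ hu] at hg
  rw [beta, leading_toeplitz, tMat_toeplitz hs h1 h2, XY_toeplitz hs h1 h2]
  set g := invSqrt (schur s k)⁻¹
  have hdet : IsUnit g.det := by
    rw [← hg, det_mul] at hu
    exact isUnit_of_mul_isUnit_right hu
  have hdet' : IsUnit gᴴ.det := by rw [det_conjTranspose]; exact hdet.star
  calc _ = g * (schur s k)⁻¹ * (schurRow s ν k * swapMat p * (schurRow s ν k)ᴴ) *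
        ((schur s k)⁻¹)ᴴ * gᴴ := by simp only [Matrix.mul_assoc, conjTranspose_mul]
    _ = _ := by
        rw [schurRow_mul_swapMat_mul hs hν h1, nonsing_inv_mul_cancel_right _ _ hu,
          conjTranspose_nonsing_inv, hδ.isHermitian.eq, ← hg, Matrix.mul_inv_rev,
          ← Matrix.mul_assoc, mul_nonsing_inv _ hdet, Matrix.one_mul, nonsing_inv_mul _ hdet']

end

/-! ### Dependence on the newest Toeplitz block -/

section

variable {p : ℕ} {s s' : ℤ → Matrix (Fin p) (Fin p) ℂ} {ν : Matrix (Fin p) (Fin p) ℂ}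

/-- `[I_p 0]`. -/
abbrev rowLeft (p : ℕ) : Matrix (Fin p) (Fin p ⊕ Fin p) ℂ := fromCols 1 0

/-- `[0 I_p]`. -/
abbrev rowRight (p : ℕ) : Matrix (Fin p) (Fin p ⊕ Fin p) ℂ := fromCols 0 1

/-- The block row `[I_p 0 … 0]` with `m+1` blocks. -/
def firstRow (p m : ℕ) : Matrix (Fin p) (Fin (m + 1) × Fin p) ℂ :=
  Matrix.of fun a x => if x.1 = 0 ∧ x.2 = a then 1 else 0

/-- The coefficient of `s_{-(m+1)}` in `schurRow s ν (m + 1)`. -/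
noncomputable def edgeRow (s : ℤ → Matrix (Fin p) (Fin p) ℂ) (ν : Matrix (Fin p) (Fin p) ℂ)
    (m : ℕ) : Matrix (Fin p) (Fin p ⊕ Fin p) ℂ :=
  rowRight p - firstRow p m * (toeplitz s (m + 1))⁻¹ * phiCols s ν (m + 1)

theorem halfSum_mul_firstRow (m : ℕ) :
    halfSum p (m + 1) * (firstRow p m)ᴴ = Phi1 p (m + 1) - (1 / 2 : ℂ) • (firstRow p m)ᴴ := by
  ext x a
  rw [halfSum_mul_apply]
  have h (l : Fin (m + 1)) : (if l < x.1 then (firstRow p m)ᴴ (l, x.2) a else 0) =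
      if l = 0 then (if 0 < x.1 ∧ x.2 = a then 1 else 0) else 0 := by
    by_cases hl : l = 0
    · subst hl
      by_cases h1 : 0 < x.1 <;> simp [firstRow, h1, apply_ite]
    · simp [firstRow, hl]
  simp only [h, Finset.sum_ite_eq', Finset.mem_univ, if_true]
  by_cases h0 : x.1 = 0
  · by_cases h1 : x.2 = a
    · simp [firstRow, Phi1, h0, h1, one_apply]
      norm_num
    · simp [firstRow, Phi1, h0, h1, one_apply]
  · have h2 : 0 < x.1 := Fin.pos_iff_ne_zero.mpr h0
    by_cases h1 : x.2 = a <;> simp [firstRow, Phi1, h0, h1, h2, one_apply]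

/-- Multiply the displacement identity by `S⁻¹` on both sides and compress to the first block. With
`G = F S⁻¹ Φ₁` the result is `G + G^* - F S⁻¹ F^*`. The cross terms with the neutral row `[0 I]`
remove `G + G^*`. -/
theorem edgeRow_mul_swapMat_mul (hs : IsHermitianSeq s) (hν : ν.IsHermitian) {m : ℕ}
    (hT : (toeplitz s (m + 1)).PosDef) :
    edgeRow s ν m * swapMat p * (edgeRow s ν m)ᴴ =
      -(firstRow p m * (toeplitz s (m + 1))⁻¹ * (firstRow p m)ᴴ) := by
  have hu := (isUnit_iff_isUnit_det _).mp hT.isUnit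
  set F := firstRow p m
  set R := (toeplitz s (m + 1))⁻¹ with hR
  set P := phiCols s ν (m + 1)
  have hRH : Rᴴ = R := by rw [hR, conjTranspose_nonsing_inv, hT.isHermitian.eq]
  set G := F * R * Phi1 p (m + 1) with hG
  have hswap : rowRight p * swapMat p = rowLeft p := by
    rw [swapMat, fromCols_mul_fromBlocks]
    simp
  have hswap2 : swapMat p * (rowRight p)ᴴ = fromRows 1 0 := by
    rw [swapMat, conjTranspose_fromCols_eq_fromRows_conjTranspose, fromBlocks_mul_fromRows]
    simp
  have e1 : F * R * P * swapMat p * (rowRight p)ᴴ = G := by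
    rw [Matrix.mul_assoc, hswap2, Matrix.mul_assoc, show P = phiCols s ν (m + 1) from rfl, phiCols,
      fromCols_mul_fromRows, Matrix.mul_one, Matrix.mul_zero, add_zero]
  have e2 : rowRight p * swapMat p * (F * R * P)ᴴ = Gᴴ := by
    have : (swapMat p)ᴴ = swapMat p := by simp [swapMat, fromBlocks_conjTranspose]
    rw [← e1, conjTranspose_mul _ (rowRight p)ᴴ, conjTranspose_mul _ (swapMat p),
      conjTranspose_conjTranspose, this, Matrix.mul_assoc]
  have e3 : rowRight p * swapMat p *
      (rowRight p)ᴴ = 0 := by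
    rw [hswap, conjTranspose_fromCols_eq_fromRows_conjTranspose, fromCols_mul_fromRows]
    simp
  have e4 : F * R * halfSum p (m + 1) * Fᴴ = G - (1 / 2 : ℂ) • (F * R * Fᴴ) := by
    rw [Matrix.mul_assoc, halfSum_mul_firstRow, Matrix.mul_sub, Matrix.mul_smul]
  have e5 : F * (halfSum p (m + 1))ᴴ * R * Fᴴ = Gᴴ - (1 / 2 : ℂ) • (F * R * Fᴴ) := by
    have := congrArg conjTranspose e4
    simp only [conjTranspose_mul, conjTranspose_sub, conjTranspose_conjTranspose, hRH,
      conjTranspose_smul] at this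
    simp only [Matrix.mul_assoc] at this ⊢
    rw [this, hG, Matrix.mul_assoc, conjTranspose_mul, conjTranspose_mul, hRH]
    congr 2
    norm_num
  have e6 : F * R * P * swapMat p * (F * R * P)ᴴ = G + Gᴴ - F * R * Fᴴ := by
    calc _ = F * R * (P * swapMat p * Pᴴ) * R * Fᴴ := by
          simp only [conjTranspose_mul, hRH, Matrix.mul_assoc]
      _ = F * R * halfSum p (m + 1) * (toeplitz s (m + 1) * R) * Fᴴ +
            F * (R * toeplitz s (m + 1)) * (halfSum p (m + 1))ᴴ * R * Fᴴ := by
          rw [← halfSum_mul_toeplitz hs hν]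
          simp only [Matrix.mul_add, Matrix.add_mul, Matrix.mul_assoc]
      _ = _ := by
          rw [hR, mul_nonsing_inv _ hu, nonsing_inv_mul _ hu, Matrix.mul_one, Matrix.mul_one, ← hR,
            e4, e5]
          module
  rw [edgeRow, conjTranspose_sub, Matrix.sub_mul, Matrix.sub_mul, Matrix.mul_sub, Matrix.mul_sub,
    e1, e2, e3, e6]
  abel

theorem firstRow_injective (m : ℕ) : Function.Injective (firstRow p m).vecMul := by
  intro v w h
  funext a
  have := congrFun h (0, a)
  simpa [vecMul, dotProduct, firstRow] using this

theorem edgeRow_negative (hs : IsHermitianSeq s) (hν : ν.IsHermitian) {m : ℕ}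
    (hT : (toeplitz s (m + 1)).PosDef) :
    (-(edgeRow s ν m * swapMat p * (edgeRow s ν m)ᴴ)).PosDef := by
  rw [edgeRow_mul_swapMat_mul hs hν hT, neg_neg]
  exact hT.inv.mul_mul_conjTranspose_same (firstRow_injective m)

/-- The sequences agree at all indices of absolute value less than `m`. -/
def AgreeBelow (s s' : ℤ → Matrix (Fin p) (Fin p) ℂ) (m : ℕ) : Prop :=
  ∀ k : ℤ, k.natAbs < m → s k = s' k

theorem AgreeBelow.toeplitz_eq {m : ℕ} (h : AgreeBelow s s' m) : toeplitz s m = toeplitz s' m := by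
  ext x y
  have := x.1.isLt
  have := y.1.isLt
  simp only [toeplitz, of_apply]
  rw [h _ (by lia)]

theorem AgreeBelow.phi_eq {m : ℕ} (h : AgreeBelow s s' (m + 1)) : phi s ν m = phi s' ν m := by
  rw [phi, phi, h 0 (by simp)]
  congr 2
  refine Finset.sum_congr rfl fun l hl => h _ ?_
  rw [Finset.mem_range] at hl
  lia

theorem AgreeBelow.mono {m n : ℕ} (h : AgreeBelow s s' n) (hmn : m ≤ n) : AgreeBelow s s' m :=
  fun k hk => h k (hk.trans_le hmn)

theorem AgreeBelow.symm {m : ℕ} (h : AgreeBelow s s' m) : AgreeBelow s' s m :=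
  fun k hk => (h k hk).symm

theorem AgreeBelow.trans {s'' : ℤ → Matrix (Fin p) (Fin p) ℂ} {m : ℕ} (h : AgreeBelow s s' m)
    (h' : AgreeBelow s' s'' m) : AgreeBelow s s'' m :=
  fun k hk => (h k hk).trans (h' k hk)

theorem AgreeBelow.phiCols_eq {m : ℕ} (h : AgreeBelow s s' m) :
    phiCols s ν m = phiCols s' ν m := by
  rw [phiCols, phiCols]
  congr 1
  ext x b
  have := x.1.isLt
  simp only [of_apply]
  rw [(h.mono (by lia) : AgreeBelow s s' (x.1 + 1)).phi_eq]

theorem AgreeBelow.lowerRow_eq {m : ℕ} (h : AgreeBelow s s' (m + 1)) :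
    lowerRow s m = lowerRow s' m := by
  ext a y
  have := y.1.isLt
  simp only [lowerRow, of_apply]
  rw [h _ (by lia)]

theorem AgreeBelow.schur_eq {m : ℕ} (h : AgreeBelow s s' (m + 1)) : schur s m = schur s' m := by
  rw [schur, schur, h 0 (by simp), h.lowerRow_eq, (h.mono m.le_succ).toeplitz_eq]

theorem AgreeBelow.schurRow_eq {m : ℕ} (h : AgreeBelow s s' (m + 1)) :
    schurRow s ν m = schurRow s' ν m := by
  rw [schurRow, schurRow, h.phi_eq, h.lowerRow_eq, (h.mono m.le_succ).toeplitz_eq,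
    (h.mono m.le_succ).phiCols_eq]

/-- The block `s_{-(m+1)}` enters only as the last summand of `phi` and as the first block of
`lowerRow`. -/
theorem AgreeBelow.schurRow_eq_add {m : ℕ} (h : AgreeBelow s s' (m + 1)) :
    schurRow s ν (m + 1) = schurRow s' ν (m + 1) +
      (s (-((m : ℤ) + 1)) - s' (-((m : ℤ) + 1))) * edgeRow s' ν m := by
  set κ := s (-((m : ℤ) + 1)) - s' (-((m : ℤ) + 1)) with hκ
  have h1 : phi s ν (m + 1) = phi s' ν (m + 1) + κ := by
    have := h.phi_eq (ν := ν)
    simp only [phi] at this ⊢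
    rw [Finset.sum_range_succ, Finset.sum_range_succ, hκ]
    calc _ = ((1 / 2 : ℂ) • s 0 + ∑ l ∈ Finset.range m, s (-((l : ℤ) + 1)) + Complex.I • ν) +
          s (-((m : ℤ) + 1)) := by abel
      _ = _ := by rw [this]; abel
  have h2 : lowerRow s (m + 1) = lowerRow s' (m + 1) + κ * firstRow p m := by
    ext a y
    have hy := y.1.isLt
    have e : (κ * firstRow p m) a y = if y.1 = 0 then κ a y.2 else 0 := by
      by_cases h0 : y.1 = 0 <;> simp [mul_apply, firstRow, h0]
    rw [Matrix.add_apply, e]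
    simp only [lowerRow, of_apply]
    split_ifs with h0
    · rw [h0, hκ]
      simp
    · rw [add_zero, h _ ?_]
      have : (y.1 : ℕ) ≠ 0 := fun h => h0 (Fin.ext h)
      lia
  rw [schurRow, schurRow, edgeRow, h1, h2, h.toeplitz_eq, h.phiCols_eq]
  have h3 : (fromCols 1 (phi s' ν (m + 1) + κ) : Matrix (Fin p) (Fin p ⊕ Fin p) ℂ) =
      fromCols 1 (phi s' ν (m + 1)) + κ * rowRight p := by
    rw [mul_fromCols, Matrix.mul_zero, Matrix.mul_one]
    ext i (j | j) <;> simp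
  rw [h3]
  simp only [Matrix.add_mul, Matrix.mul_sub, Matrix.mul_assoc]
  generalize κ * rowRight p = x
  abel

/-- The sequence `s` with `s_{-(m+1)}` replaced by `κ`, and `s_{m+1}` by `κ^*`. -/
def updateSeq (s : ℤ → Matrix (Fin p) (Fin p) ℂ) (m : ℕ) (κ : Matrix (Fin p) (Fin p) ℂ) :
    ℤ → Matrix (Fin p) (Fin p) ℂ :=
  fun k => if k = -((m : ℤ) + 1) then κ else if k = (m : ℤ) + 1 then κᴴ else s k

theorem updateSeq_isHermitianSeq (hs : IsHermitianSeq s) (m : ℕ) (κ : Matrix (Fin p) (Fin p) ℂ) :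
    IsHermitianSeq (updateSeq s m κ) := by
  intro k
  simp only [updateSeq]
  by_cases h1 : k = (m : ℤ) + 1
  · subst h1
    rw [if_pos rfl, if_neg (by lia), if_pos rfl, conjTranspose_conjTranspose]
  · by_cases h2 : k = -((m : ℤ) + 1)
    · subst h2
      rw [if_neg (by lia), if_pos (by lia), if_pos rfl]
    · rw [if_neg (by lia), if_neg (by lia), if_neg h2, if_neg h1, hs]

theorem updateSeq_agreeBelow (s : ℤ → Matrix (Fin p) (Fin p) ℂ) (m : ℕ)
    (κ : Matrix (Fin p) (Fin p) ℂ) : AgreeBelow (updateSeq s m κ) s (m + 1) := by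
  intro k hk
  simp only [updateSeq]
  rw [if_neg (by lia), if_neg (by lia)]

theorem updateSeq_apply (s : ℤ → Matrix (Fin p) (Fin p) ℂ) (m : ℕ)
    (κ : Matrix (Fin p) (Fin p) ℂ) : updateSeq s m κ (-((m : ℤ) + 1)) = κ := if_pos rfl

/-- The central one-step extension. -/
theorem exists_central_extension (hs : IsHermitianSeq s) {m : ℕ}
    (hT : (toeplitz s (m + 1)).PosDef) :
    ∃ c : ℤ → Matrix (Fin p) (Fin p) ℂ, IsHermitianSeq c ∧ AgreeBelow c s (m + 1) ∧
      schur c (m + 1) = schur s m := by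
  set w := lowerRow s m * (toeplitz s m)⁻¹ with hw
  have hTm := toeplitz_posDef_of_le m.le_succ hT
  -- This block makes the new lower row equal to `[0 w]` times `toeplitz s (m + 1)`, so elimination
  -- uses the old coefficients `w` and leaves the Schur complement unchanged.
  set c := updateSeq s m (w * (upperRow s m)ᴴ) with hc
  have hcs : AgreeBelow c s (m + 1) := updateSeq_agreeBelow s m _
  refine ⟨c, updateSeq_isHermitianSeq hs m _, hcs, ?_⟩
  have h1 : (lowerRow c (m + 1)).submatrix id (splitFirst p m) =
      fromCols (w * (upperRow s m)ᴴ) (lowerRow s m) := by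
    ext a (b | y)
    · have e : ((0 : Fin (m + 1)) : ℤ) - ((m + 1 : ℕ) : ℤ) = -((m : ℤ) + 1) := by simp
      simp only [lowerRow, splitFirst, submatrix_apply, of_apply, id, Equiv.coe_fn_mk,
        Sum.elim_inl, fromCols_apply_inl]
      rw [e, hc, updateSeq_apply]
    · have hy := y.1.isLt
      have e : (y.1.succ : ℤ) - ((m + 1 : ℕ) : ℤ) = (y.1 : ℤ) - m := by simp
      simp only [lowerRow, splitFirst, submatrix_apply, of_apply, id, Equiv.coe_fn_mk,
        Sum.elim_inr, fromCols_apply_inr]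
      rw [e, hcs _ (by lia)]
  have h2 : (fromCols 0 w).submatrix id (splitFirst p m).symm * toeplitz s (m + 1) =
      lowerRow c (m + 1) := by
    have h3 : ((fromCols 0 w).submatrix id (splitFirst p m).symm *
        toeplitz s (m + 1)).submatrix id (splitFirst p m) =
        (lowerRow c (m + 1)).submatrix id (splitFirst p m) := by
      rw [← submatrix_mul_equiv _ _ _ (splitFirst p m), toeplitz_submatrix_splitFirst hs,
        submatrix_submatrix, h1]
      simp only [Function.comp_id, Equiv.symm_comp_self, submatrix_id_id, fromCols_mul_fromBlocks,
        Matrix.zero_mul, zero_add]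
      rw [hw, nonsing_inv_mul_cancel_right _ _ ((isUnit_iff_isUnit_det _).mp hTm.isUnit)]
    have h4 := congrArg (fun A => A.submatrix id (splitFirst p m).symm) h3
    simpa only [submatrix_submatrix, Function.comp_id, Equiv.self_comp_symm, submatrix_id_id]
      using h4
  rw [schur, schur, hcs.toeplitz_eq, hcs 0 (by simp)]
  nth_rewrite 1 [← h2]
  rw [mul_nonsing_inv_cancel_right _ _ ((isUnit_iff_isUnit_det _).mp hT.isUnit),
    mul_eq_submatrix_mul_submatrix _ _ (splitFirst p m), ← conjTranspose_submatrix, h1,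
    submatrix_submatrix]
  simp only [Function.comp_id, Equiv.symm_comp_self, submatrix_id_id,
    conjTranspose_fromCols_eq_fromRows_conjTranspose, fromCols_mul_fromRows, Matrix.zero_mul,
    zero_add]
  rw [hw]

/-- `A δ A^* = 1`, hence `δ⁻¹ = A^*A`. Positivity of the Schur complement thus comes for free from
the normalisation of `γ`. -/
theorem posDef_and_eq_of_eq_mul {γ M : Matrix (Fin p) (Fin p ⊕ Fin p) ℂ} {J : Mat2 p}
    {A δ : Matrix (Fin p) (Fin p) ℂ} (hA : IsUnit A.det) (hγ : γ = A * M) (hδ : M * J * Mᴴ = δ)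
    (h1 : γ * J * γᴴ = 1) : δ.PosDef ∧ Mᴴ * δ⁻¹ * M = γᴴ * γ := by
  have hA' : IsUnit Aᴴ.det := by rw [det_conjTranspose]; exact hA.star
  have e : A * δ * Aᴴ = 1 := by
    rw [← h1, hγ, ← hδ, conjTranspose_mul]
    simp only [Matrix.mul_assoc]
  have e2 : (Aᴴ * A) * δ = 1 := by
    rw [mul_eq_one_comm, ← Matrix.mul_assoc, mul_eq_one_comm, ← Matrix.mul_assoc]
    exact e
  have e3 : δ⁻¹ = Aᴴ * A := inv_eq_left_inv e2
  refine ⟨?_, ?_⟩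
  · rw [← posDef_inv_iff, e3]
    exact PosDef.conjTranspose_mul_self _
      (mulVec_injective_iff_isUnit.mpr ((isUnit_iff_isUnit_det _).mpr hA))
  · rw [e3, hγ, conjTranspose_mul]
    simp only [Matrix.mul_assoc]

theorem toeplitz_zero_posDef (s : ℤ → Matrix (Fin p) (Fin p) ℂ) : (toeplitz s 0).PosDef := by
  rw [Subsingleton.elim (toeplitz s 0) 1]
  exact PosDef.one

theorem schur_zero (s : ℤ → Matrix (Fin p) (Fin p) ℂ) : schur s 0 = s 0 := by
  rw [schur, Subsingleton.elim (lowerRow s 0) 0, Matrix.zero_mul, Matrix.zero_mul, sub_zero]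

theorem schurRow_zero (s : ℤ → Matrix (Fin p) (Fin p) ℂ) (ν : Matrix (Fin p) (Fin p) ℂ) :
    schurRow s ν 0 = rowLeft p +
      ((1 / 2 : ℂ) • s 0 + Complex.I • ν) * rowRight p := by
  rw [schurRow, Subsingleton.elim (lowerRow s 0) 0, Matrix.zero_mul, Matrix.zero_mul, sub_zero, phi,
    Finset.sum_range_zero, add_zero, mul_fromCols, Matrix.mul_zero, Matrix.mul_one]
  ext i (j | j) <;> simp

theorem isUnit_det_fromRows_fromCols :
    IsUnit (fromRows (rowLeft p) (rowRight p)).det := by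
  rw [fromRows_fromCols_eq_fromBlocks, fromBlocks_one, det_one]
  exact isUnit_one

end

/-! ### The bijection -/

section

variable {p : ℕ} {s s' : ℤ → Matrix (Fin p) (Fin p) ℂ} {ν ν' : Matrix (Fin p) (Fin p) ℂ}

theorem swapMat_isHermitian : (swapMat p).IsHermitian := by
  simp [swapMat, IsHermitian, fromBlocks_conjTranspose]

theorem rowRight_mul_swapMat_mul : rowRight p * swapMat p * (rowRight p)ᴴ = 0 := by
  rw [swapMat, fromCols_mul_fromBlocks, conjTranspose_fromCols_eq_fromRows_conjTranspose,
    fromCols_mul_fromRows]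
  simp

theorem mem_toeplitzPairs_iff {n : ℕ} (q : BlockMatrix p n × Matrix (Fin p) (Fin p) ℂ) :
    q ∈ toeplitzPairs p n ↔ ∃ s : ℤ → Matrix (Fin p) (Fin p) ℂ, IsHermitianSeq s ∧
      (toeplitz s n).PosDef ∧ q.2.IsHermitian ∧ q = (toeplitz s n, q.2) := by
  constructor
  · rintro ⟨⟨s, hs⟩, hq, hν⟩
    have hT (i j : Fin n) (a b : Fin p) : q.1 (i, a) (j, b) = s ((j : ℤ) - i) a b :=
      congrFun (congrFun (hs i j) a) b
    -- Values at indices that do not occur in `S` are unconstrained; zero keeps the sequence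
    -- Hermitian.
    let c : ℤ → Matrix (Fin p) (Fin p) ℂ := fun k => if k.natAbs < n then s k else 0
    have hc : q.1 = toeplitz c n := by
      ext ⟨i, a⟩ ⟨j, b⟩
      have := i.isLt
      have := j.isLt
      simp only [toeplitz, of_apply, c]
      rw [if_pos (by lia), hT]
    have hc' : IsHermitianSeq c := by
      intro k
      simp only [c, Int.natAbs_neg]
      split_ifs with hk
      · ext a b
        have key (i j : Fin n) : s ((j : ℤ) - i) a b = star (s ((i : ℤ) - j) b a) := by
          rw [← hT, ← hT, ← conjTranspose_apply, hq.isHermitian.eq]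
        rw [conjTranspose_apply]
        rcases le_total 0 k with h0 | h0
        · have := key ⟨k.natAbs, hk⟩ ⟨0, by lia⟩
          simpa [abs_of_nonneg h0] using this
        · have := key ⟨0, by lia⟩ ⟨k.natAbs, hk⟩
          simpa [abs_of_nonpos h0] using this
      · simp
    exact ⟨c, hc', hc ▸ hq, hν, Prod.ext hc rfl⟩
  · rintro ⟨s, hs, hT, hν, hq⟩
    rw [hq]
    exact ⟨⟨s, fun i j => rfl⟩, hT, hν⟩

theorem gamma_mul_jMat_mul {β : Matrix (Fin p) (Fin p ⊕ Fin p) ℂ}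
    (h : β * swapMat p * βᴴ = 1) : β * KMat p * jMat p * (β * KMat p)ᴴ = 1 := by
  rw [← h, ← KMat_mul_jMat_mul, conjTranspose_mul]
  simp only [Matrix.mul_assoc]

theorem potential_eq {n : ℕ} (q : BlockMatrix p n × Matrix (Fin p) (Fin p) ℂ) (k : Fin n) :
    potential q k = (2 : ℂ) • ((beta q.1 q.2 k * KMat p)ᴴ * (beta q.1 q.2 k * KMat p)) - jMat p := by
  simp only [potential, conjTranspose_mul, Matrix.mul_assoc]

theorem two_smul_sub_jMat_inj {Q Q' : Mat2 p} :
    (2 : ℂ) • ((KMat p)ᴴ * Q * KMat p) - jMat p = (2 : ℂ) • ((KMat p)ᴴ * Q' * KMat p) - jMat p ↔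
      Q = Q' := by
  refine ⟨fun h => ?_, fun h => h ▸ rfl⟩
  have h1 := smul_right_injective _ (two_ne_zero (α := ℂ)) (sub_left_injective h)
  have hK : IsUnit (KMat p) := IsUnit.of_mul_eq_one _ KMat_mul_conjTranspose
  have hK' : IsUnit (KMat p)ᴴ := IsUnit.of_mul_eq_one _ KMat_conjTranspose_mul
  exact hK'.mul_right_injective (hK.mul_left_injective h1)

theorem potential_toeplitz (hs : IsHermitianSeq s) {n : ℕ} (hT : (toeplitz s n).PosDef)
    (k : Fin n) : potential (toeplitz s n, ν) k = (2 : ℂ) • ((KMat p)ᴴ *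
      ((schurRow s ν k)ᴴ * (schur s k)⁻¹ * schurRow s ν k) * KMat p) - jMat p := by
  rw [potential, ← beta_conjTranspose_mul_self hs hT]
  simp only [Matrix.mul_assoc]

theorem potential_mem_diracPotentials {n : ℕ} (q : BlockMatrix p n × Matrix (Fin p) (Fin p) ℂ)
    (hq : q ∈ toeplitzPairs p n) : potential q ∈ diracPotentials p n := by
  obtain ⟨s, hs, hT, hν, hqs⟩ := (mem_toeplitzPairs_iff q).mp hq
  intro k
  rw [potential_eq]
  have : beta q.1 q.2 k * KMat p * jMat p * (beta q.1 q.2 k * KMat p)ᴴ = 1 := by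
    rw [hqs]
    exact gamma_mul_jMat_mul (beta_mul_swapMat_mul hs hν hT k)
  exact ⟨two_smul_sub_jMat_posDef this, two_smul_sub_jMat_mul this⟩

/-- Rows `schurRow c ν (m + 1)` and `edgeRow c ν m` at the central extension form a basis. -/
theorem isUnit_det_central (hs : IsHermitianSeq s) (hν : ν.IsHermitian) {m : ℕ}
    (hT : (toeplitz s (m + 1)).PosDef) {c : ℤ → Matrix (Fin p) (Fin p) ℂ} (hc : IsHermitianSeq c)
    (hcs : AgreeBelow c s (m + 1)) (hδ : schur c (m + 1) = schur s m) :
    IsUnit (fromRows (schurRow c ν (m + 1)) (edgeRow c ν m)).det := by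
  have hTc : (toeplitz c (m + 1)).PosDef := hcs.toeplitz_eq ▸ hT
  refine isUnit_det_fromRows swapMat_isHermitian ?_ (edgeRow_negative hc hν hTc)
  rw [schurRow_mul_swapMat_mul hc hν hTc, hδ]
  exact (toeplitz_succ_posDef_iff hs (toeplitz_posDef_of_le m.le_succ hT)).mp hT

/-- Surjectivity: each `γ k` selects the next block, and extending the sequence leaves earlier
`schurRow` and `schur` untouched. -/
theorem exists_toeplitz_schurRow (γ : ℕ → Matrix (Fin p) (Fin p ⊕ Fin p) ℂ) (m : ℕ)
    (hγ : ∀ k ≤ m, γ k * swapMat p * (γ k)ᴴ = 1) :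
    ∃ (s : ℤ → Matrix (Fin p) (Fin p) ℂ) (ν : Matrix (Fin p) (Fin p) ℂ), IsHermitianSeq s ∧
      ν.IsHermitian ∧ (toeplitz s (m + 1)).PosDef ∧
      ∀ k ≤ m, (schurRow s ν k)ᴴ * (schur s k)⁻¹ * schurRow s ν k = (γ k)ᴴ * γ k := by
  induction m with
  | zero =>
    have h0 : -(rowRight p * swapMat p * (rowRight p)ᴴ) = 0 := by
      rw [rowRight_mul_swapMat_mul, neg_zero]
    -- Here `Y = [0 I]` is neutral rather than negative, which is why only semidefiniteness is asked
    -- of `Y`.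
    obtain ⟨A, μ, hA, hγA⟩ := exists_eq_mul_add_mul isUnit_det_fromRows_fromCols
      (h0 ▸ PosSemidef.zero) (hγ 0 le_rfl)
    -- `μ = s_0/2 + iν` is the splitting into Hermitian and skew-Hermitian parts.
    let s : ℤ → Matrix (Fin p) (Fin p) ℂ := fun k => if k = 0 then μ + μᴴ else 0
    let ν : Matrix (Fin p) (Fin p) ℂ := (-(Complex.I / 2)) • (μ - μᴴ)
    have hs : IsHermitianSeq s := by
      intro k
      by_cases hk : k = 0
      · simp [s, hk, add_comm]
      · simp [s, hk]
    have hν : ν.IsHermitian := by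
      simp only [ν, IsHermitian, conjTranspose_smul, conjTranspose_sub, conjTranspose_conjTranspose]
      rw [← neg_sub μ, smul_neg, ← neg_smul]
      congr 1
      simp [neg_div]
    have hμ : (1 / 2 : ℂ) • s 0 + Complex.I • ν = μ := by
      simp only [s, ν, if_pos, smul_smul]
      have : Complex.I * -(Complex.I / 2) = 1 / 2 := by
        linear_combination (-1 / 2 : ℂ) * Complex.I_mul_I
      rw [this]
      module
    rw [← hμ, ← schurRow_zero] at hγA
    obtain ⟨h1, h2⟩ := posDef_and_eq_of_eq_mul hA hγA
      (schurRow_mul_swapMat_mul hs hν (toeplitz_zero_posDef s)) (hγ 0 le_rfl)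
    refine ⟨s, ν, hs, hν, (toeplitz_succ_posDef_iff hs (toeplitz_zero_posDef s)).mpr h1, ?_⟩
    intro k hk
    obtain rfl : k = 0 := by lia
    exact h2
  | succ m ih =>
    obtain ⟨s, ν, hs, hν, hT, hsk⟩ := ih fun k hk => hγ k (hk.trans m.le_succ)
    obtain ⟨c, hc, hcs, hδ⟩ := exists_central_extension hs hT
    have hTc : (toeplitz c (m + 1)).PosDef := hcs.toeplitz_eq ▸ hT
    obtain ⟨A, σ, hA, hγA⟩ := exists_eq_mul_add_mul (isUnit_det_central hs hν hT hc hcs hδ)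
      (edgeRow_negative hc hν hTc).posSemidef (hγ (m + 1) le_rfl)
    -- Moving the new block away from its central value by `σ` turns `X` into `X + σY`.
    set r := updateSeq c m (c (-((m : ℤ) + 1)) + σ) with hr
    have hrc : AgreeBelow r c (m + 1) := updateSeq_agreeBelow c m _
    have hrH : IsHermitianSeq r := updateSeq_isHermitianSeq hc m _
    have hTr : (toeplitz r (m + 1)).PosDef := hrc.toeplitz_eq ▸ hTc
    have e : schurRow r ν (m + 1) = schurRow c ν (m + 1) + σ * edgeRow c ν m := by
      rw [hrc.schurRow_eq_add, hr, updateSeq_apply, add_sub_cancel_left]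
    rw [← e] at hγA
    obtain ⟨h1, h2⟩ := posDef_and_eq_of_eq_mul hA hγA
      (schurRow_mul_swapMat_mul hrH hν hTr) (hγ (m + 1) le_rfl)
    refine ⟨r, ν, hrH, hν, (toeplitz_succ_posDef_iff hrH hTr).mpr h1, fun k hk => ?_⟩
    rcases hk.lt_or_eq with hk' | rfl
    · have hrs : AgreeBelow r s (k + 1) := (hrc.trans hcs).mono (by lia)
      rw [hrs.schurRow_eq, hrs.schur_eq, hsk k (by lia)]
    · exact h2

/-- Injectivity: once the earlier blocks agree, both sequences are expanded about the same central
extension `c`, and the coefficient `σ` is unique. -/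
theorem agreeBelow_of_schurRow (hs : IsHermitianSeq s) (hs' : IsHermitianSeq s')
    (hν : ν.IsHermitian) (m : ℕ) (hT : (toeplitz s (m + 1)).PosDef)
    (hT' : (toeplitz s' (m + 1)).PosDef)
    (h : ∀ k ≤ m, (schurRow s ν k)ᴴ * (schur s k)⁻¹ * schurRow s ν k =
      (schurRow s' ν' k)ᴴ * (schur s' k)⁻¹ * schurRow s' ν' k) :
    AgreeBelow s s' (m + 1) ∧ ν = ν' := by
  have hunit {r : ℤ → Matrix (Fin p) (Fin p) ℂ} (hr : IsHermitianSeq r) {k : ℕ}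
      (hTr : (toeplitz r (k + 1)).PosDef) : IsUnit (schur r k).det :=
    (isUnit_iff_isUnit_det _).mp
      ((toeplitz_succ_posDef_iff hr (toeplitz_posDef_of_le k.le_succ hTr)).mp hTr).isUnit
  induction m with
  | zero =>
    have h0 := h 0 le_rfl
    rw [schurRow_zero, schurRow_zero] at h0
    obtain ⟨h1, h2⟩ := eq_of_conjTranspose_mul_mul_eq isUnit_det_fromRows_fromCols
      (isUnit_nonsing_inv_det _ (hunit hs hT)) h0
    have h3 : s 0 = s' 0 := by
      rw [← schur_zero s, ← schur_zero s', ← nonsing_inv_nonsing_inv _ (hunit hs hT), h1,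
        nonsing_inv_nonsing_inv _ (hunit hs' hT')]
    rw [h3] at h2
    refine ⟨fun k hk => ?_, smul_right_injective _ Complex.I_ne_zero (add_left_cancel h2)⟩
    obtain rfl : k = 0 := by lia
    exact h3
  | succ m ih =>
    have hTm := toeplitz_posDef_of_le (m + 1).le_succ hT
    obtain ⟨hss', rfl⟩ := ih hTm (toeplitz_posDef_of_le (m + 1).le_succ hT')
      fun k hk => h k (hk.trans m.le_succ)
    refine ⟨?_, rfl⟩
    obtain ⟨c, hc, hcs, hδ⟩ := exists_central_extension hs hTm
    have h0 := h (m + 1) le_rfl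
    rw [hcs.symm.schurRow_eq_add, (hcs.trans hss').symm.schurRow_eq_add] at h0
    obtain ⟨-, h1⟩ := eq_of_conjTranspose_mul_mul_eq (isUnit_det_central hs hν hTm hc hcs hδ)
      (isUnit_nonsing_inv_det _ (hunit hs hT)) h0
    have h2 := sub_left_injective h1
    intro k hk
    by_cases hk1 : k.natAbs < m + 1
    · exact hss' k hk1
    · rcases (by lia : k = -((m : ℤ) + 1) ∨ k = (m : ℤ) + 1) with rfl | rfl
      · exact h2
      · have := congrArg conjTranspose h2
        rwa [← hs, ← hs', neg_neg] at this

theorem potential_injOn (p n : ℕ) (hn : 1 ≤ n) :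
    Set.InjOn (potential (p := p) (n := n)) (toeplitzPairs p n) := by
  intro q hq q' hq' h
  obtain ⟨s, hs, hT, hν, hqs⟩ := (mem_toeplitzPairs_iff q).mp hq
  obtain ⟨s', hs', hT', -, hqs'⟩ := (mem_toeplitzPairs_iff q').mp hq'
  -- `ν` is recovered from `C_0`, so at least one coefficient is needed.
  obtain ⟨m, rfl⟩ : ∃ m, n = m + 1 := ⟨n - 1, by lia⟩
  rw [hqs, hqs'] at h ⊢
  obtain ⟨h1, h2⟩ := agreeBelow_of_schurRow hs hs' hν m hT hT' (ν' := q'.2) fun k hk => by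
    have := congrFun h ⟨k, by lia⟩
    rw [potential_toeplitz hs hT, potential_toeplitz hs' hT', two_smul_sub_jMat_inj] at this
    exact this
  rw [h1.toeplitz_eq, h2]

theorem potential_surjOn (p n : ℕ) (hn : 1 ≤ n) :
    Set.SurjOn (potential (p := p) (n := n)) (toeplitzPairs p n) (diracPotentials p n) := by
  intro C hC
  obtain ⟨m, rfl⟩ : ∃ m, n = m + 1 := ⟨n - 1, by lia⟩
  choose g hg hCg using fun k => exists_eq_two_smul_sub_jMat (hC k).1 (hC k).2
  obtain ⟨s, ν, hs, hν, hT, hsν⟩ := exists_toeplitz_schurRow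
    -- `β = γK^*` inverts `γ = βK`; the default `0` is never reached for `k ≤ m`.
    (fun k => if hk : k < m + 1 then g ⟨k, hk⟩ * (KMat p)ᴴ else 0) m fun k hk => by
      rw [dif_pos (by lia)]
      rw [← hg ⟨k, by lia⟩, ← KMat_mul_jMat_mul, conjTranspose_mul, conjTranspose_conjTranspose]
      simp only [Matrix.mul_assoc]
      simp only [← Matrix.mul_assoc (KMat p)ᴴ (KMat p), KMat_conjTranspose_mul, Matrix.one_mul]
  refine ⟨(toeplitz s (m + 1), ν), ⟨⟨s, fun i j => rfl⟩, hT, hν⟩, ?_⟩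
  funext k
  rw [potential_toeplitz hs hT, hsν k (by lia), hCg k, dif_pos k.isLt, conjTranspose_mul,
    conjTranspose_conjTranspose]
  congr 2
  simp only [Matrix.mul_assoc, KMat_conjTranspose_mul, Matrix.mul_one]
  rw [← Matrix.mul_assoc, KMat_conjTranspose_mul, Matrix.one_mul]

theorem potential_bijOn (p n : ℕ) (hn : 1 ≤ n) :
    Set.BijOn (potential (p := p) (n := n)) (toeplitzPairs p n) (diracPotentials p n) :=
  ⟨potential_mem_diracPotentials, potential_injOn p n hn, potential_surjOn p n hn⟩

theorem diracSystem_bijOn (p n : ℕ) :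
    Set.BijOn (diracSystem (p := p) (n := n)) (diracPotentials p n) (diracSystems p n) :=
  ⟨fun C hC => ⟨C, hC, rfl⟩, diracSystem_injOn p n, fun _ ⟨C, hC, hE⟩ => ⟨C, hC, hE.symm⟩⟩

end

end ToeplitzDirac

theorem mainTheorem3 (p n : ℕ) (hn : 1 ≤ n) :
    Set.BijOn ToeplitzDirac.potential
      (ToeplitzDirac.toeplitzPairs p n) (ToeplitzDirac.diracPotentials p n) ∧
    Set.BijOn (fun q => ToeplitzDirac.diracSystem (ToeplitzDirac.potential q))
      (ToeplitzDirac.toeplitzPairs p n) (ToeplitzDirac.diracSystems p n) :=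
  ⟨ToeplitzDirac.potential_bijOn p n hn,
    (ToeplitzDirac.diracSystem_bijOn p n).comp (ToeplitzDirac.potential_bijOn p n hn)⟩
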